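/- All polars are taken with respect to the standard pairing on $\mathbb R^n$: $K^\circ=\{p:\langle p,x\rangle\le 1\ \forall x\in K\}$. For a body $K$ let $g_K$ be the (gauge) norm with unit body $K$. A point $x\in\partial K$ is smooth if $g_K$ is differentiable at $x$ (for polytopes: $x$ lies in the relative interior of a facet), and then $n_K(x)=dg_K(x)$ is the outer normal. $K\oplus_1L$ and $K\oplus_\infty L$ are the unit bodies of the norms $g_K+g_L$ and $\max\{g_K,g_L\}$ on $\mathbb R^{k+l}$. Hanner polytopes are the bodies obtained from $[-1,1]\subset\mathbb R^1$ by the operations $\oplus_1$ and $\oplus_\infty$. The billiard rules in $K\times T$ take $(q,p)$ to $(q',p')$, where $q,q'$ are smooth points of $\partial K$, $p,p'$ are smooth points of $\partial T$, $p'-p=-\lambda n_K(q)$ and $q'-q=\mu\, n_T(p')$ for some $\lambda,\mu>0$. A classical billiard trajectory in $K\times T$ is a cyclic sequence $(q_i,p_i)$, $i\in\mathbb Z/m$, $m\ge2$, in which each $(q_i,p_i)$ is followed by $(q_{i+1},p_{i+1})$ according to these rules. It is simple if it does not pass the same route several times, that is, $(q_i)$ has no period smaller than $m$. **Theorem.**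 Let $K\subset\mathbb R^k$ and $L\subset\mathbb R^l$ be Hanner polytopes, let $Q^1=(q^1_i)$ with momenta $(p^1_i)$ and $Q^2=(q^2_i)$ with momenta $(p^2_i)$ be simple classical billiard trajectories in $K\times K^\circ$ and $L\times L^\circ$, and let $H=K\oplus_1L\subset\mathbb R^{k+l}$. Then for every $\alpha\in(0,1)$ and for all but finitely many $\beta\in(0,1)$ the initial data $$q_1=(\alpha q^1_1,(1-\alpha)q^2_1),\qquad p_1=(\beta p^1_1+(1-\beta)p^1_2,\;p^2_1)$$ has a unique infinite forward extension by the billiard rules in $H\times H^\circ$, and this extension is a simple classical billiard trajectory in $H\times H^\circ$ (traversed periodically) such that 1. the projection of its coordinate polygonal line on the first $k$ coordinates coincides with (in particular, is congruent to) $\alpha Q^1$, and the projection on the last $l$ coordinates coincides with (in particular, is congruent to) $(1-\alpha)Q^2$; 2. the projection of its momentum polygonal line on the first $k$ coordinates coincides with the momentum polygonal line of $Q^1$, and the projection on the last $l$ coordinates coincides with that of $Q^2$. Here two closed polygonal lines coincide if they are the same oriented closed line, each passed once, up to listing additional vertices on the edges and repeating vertices. -/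

import Mathlib

/-- The (one-sided) polar body of `K ⊆ ℝⁿ`, with `ℝⁿ` paired with itself by the dot product. -/
def polarBody {n : ℕ} (K : Set (Fin n → ℝ)) : Set (Fin n → ℝ) :=
  {p | ∀ x ∈ K, dotProduct p x ≤ 1}

/-- The projection of `ℝ^(k+l)` on the first `k` coordinates. -/
def firstPart {k l : ℕ} (x : Fin (k + l) → ℝ) : Fin k → ℝ := fun i => x (Fin.castAdd l i)

/-- The projection of `ℝ^(k+l)` on the last `l` coordinates. -/
def lastPart {k l : ℕ} (x : Fin (k + l) → ℝ) : Fin l → ℝ := fun j => x (Fin.natAdd k j)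

/-- `K ⊕₁ L`: the unit body of the sum of the norms with unit bodies `K` and `L`
(the norm with unit body `K` is the gauge of `K`). -/
def oplusOne {k l : ℕ} (K : Set (Fin k → ℝ)) (L : Set (Fin l → ℝ)) : Set (Fin (k + l) → ℝ) :=
  {x | gauge K (firstPart x) + gauge L (lastPart x) ≤ 1}

/-- `K ⊕_∞ L`: the unit body of the maximum of the norms with unit bodies `K` and `L`. -/
def oplusInf {k l : ℕ} (K : Set (Fin k → ℝ)) (L : Set (Fin l → ℝ)) : Set (Fin (k + l) → ℝ) :=
  {x | max (gauge K (firstPart x)) (gauge L (lastPart x)) ≤ 1}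

/-- Hanner polytopes: `[-1,1]` in dimension one, closed under `⊕₁` and `⊕_∞`. -/
inductive IsHanner : (n : ℕ) → Set (Fin n → ℝ) → Prop
  | segment : IsHanner 1 (Set.Icc (-1) 1)
  | sumOne {k l : ℕ} {K : Set (Fin k → ℝ)} {L : Set (Fin l → ℝ)} :
      IsHanner k K → IsHanner l L → IsHanner (k + l) (oplusOne K L)
  | sumInf {k l : ℕ} {K : Set (Fin k → ℝ)} {L : Set (Fin l → ℝ)} :
      IsHanner k K → IsHanner l L → IsHanner (k + l) (oplusInf K L)

/-- `x` lies on the smooth piece of `∂K`, i.e. the norm with unit body `K` has a differential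
at the boundary point `x`. For a polytope: `x` is in the relative interior of a facet. -/
def IsSmoothBoundaryPoint {n : ℕ} (K : Set (Fin n → ℝ)) (x : Fin n → ℝ) : Prop :=
  x ∈ frontier K ∧ DifferentiableAt ℝ (gauge K) x

/-- The outer normal `n_K(x)`: the differential at `x` of the norm with unit body `K`,
written as a vector through the dot product. -/
noncomputable def outerNormal {n : ℕ} (K : Set (Fin n → ℝ)) (x : Fin n → ℝ) : Fin n → ℝ :=
  fun i => fderiv ℝ (gauge K) x (Pi.single i 1)

/-- One step of the classical billiard in `K × T`, from `(q, p)` to `(q', p')`. The momentum `p`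
with which one arrives at `q` is reflected to `p' = p - a n_K(q)`, `a > 0`, and then one moves with
velocity `n_T(p')` to the next point `q' = q + b n_T(p')`, `b > 0`. All points lie on the smooth
pieces of the boundaries. -/
structure BilliardStep {n : ℕ} (K T : Set (Fin n → ℝ)) (q p q' p' : Fin n → ℝ) : Prop where
  smooth_q : IsSmoothBoundaryPoint K q
  smooth_p : IsSmoothBoundaryPoint T p
  smooth_q' : IsSmoothBoundaryPoint K q'
  smooth_p' : IsSmoothBoundaryPoint T p'
  reflect : ∃ a : ℝ, 0 < a ∧ p' - p = -(a • outerNormal K q)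
  move : ∃ b : ℝ, 0 < b ∧ q' - q = b • outerNormal T p'

/-- A closed classical billiard trajectory with `m` bounces: coordinates `q` and momenta `p`,
both indexed by the integers and `m`-periodic. -/
structure IsClassicalTrajectory {n : ℕ} (K T : Set (Fin n → ℝ)) (m : ℕ)
    (q p : ℤ → Fin n → ℝ) : Prop where
  two_le : 2 ≤ m
  periodic_q : ∀ i, q (i + m) = q i
  periodic_p : ∀ i, p (i + m) = p i
  step : ∀ i, BilliardStep K T (q i) (p i) (q (i + 1)) (p (i + 1))

/-- A closed classical trajectory is simple if it does not pass the same route several times,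
i.e. its cyclic sequence of bounce points has no period smaller than `m`. -/
structure IsSimpleClassicalTrajectory {n : ℕ} (K T : Set (Fin n → ℝ)) (m : ℕ)
    (q p : ℤ → Fin n → ℝ) : Prop extends IsClassicalTrajectory K T m q p where
  simple : ∀ d : ℕ, 0 < d → d < m → ¬ ∀ i, q (i + d) = q i

/-- The polygonal line with vertices `R i`, parametrized so that `R i` is passed at time `i`. -/
noncomputable def polygonPoint {n : ℕ} (R : ℤ → Fin n → ℝ) (t : ℝ) : Fin n → ℝ :=
  AffineMap.lineMap (R ⌊t⌋) (R (⌊t⌋ + 1)) (Int.fract t)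

/-- The closed polygonal line with the `N`-periodic vertex sequence `P` coincides with the one with
the `m`-periodic vertex sequence `R`, except that `P` may list extra (or repeated) vertices lying
on the edges of `R`: the vertices `P j` are the points of the line `R` at times `c j`, the times
are nondecreasing and include all integers (so that every vertex of `R` is listed), and the line
`R` is passed exactly once while `P` is passed once. -/
def SameClosedPolygon {n : ℕ} (N : ℕ) (P : ℤ → Fin n → ℝ) (m : ℕ) (R : ℤ → Fin n → ℝ) : Prop :=
  ∃ c : ℤ → ℝ, Monotone c ∧ (∀ j, c (j + N) = c j + m) ∧
    (∀ j, P j = polygonPoint R (c j)) ∧ ∀ i : ℤ, ∃ j, c j = i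

/-! ### Unit bodies of norms and their polars -/

/-! Follow the momentum rather than the coordinate. Give reflection number `i` a time `σ i`, so that
between reflections the momentum moves with velocity `-n_K(q_i)`. For `H = K ⊕₁ L` the normal at
`(x, y)` is the pair `(n_K(x), n_L(y))`, and `H°` is the product `K° ⊕_∞ L°`. So the two components
of the momentum move independently, each as in its own billiard. When the first component reaches
`∂K°` while the second is interior, the normal of `H°` is `(n_{K°}, 0)`: only the first block of the
coordinate moves, and the norms of the two blocks stay `α` and `1 - α`. Hence two trajectories, run
simultaneously on one clock, make a trajectory in `H × H°`, as long as no two of their reflections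
happen at the same time.

The superposition closes after one passage of each because every simple closed trajectory takes time
exactly four. This rests on `IsHanner.isAntipodal`: after time two, every closed trajectory is in
the antipodal state. The proof is by induction over the construction of Hanner polytopes. The
segment is a direct check. For `⊕₁` a trajectory is split into its components, and the hypothesis
applies to each of them. The case `⊕_∞` follows by exchanging coordinates and momenta.
`IsTimedTrajectory.action_eq_four` then excludes the proper odd fractions of four: the speed is at
most one in the norm of `K°`, and antipodal boundary points are at distance two.

The parameter `β` shifts one clock against the other. By periodicity only finitely many shifts in a
bounded range make reflections coincide; these give the exceptional `β`. Uniqueness of the extension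
comes from `IsHanner.dotProduct_normals`: the normals of `K` and `K°` pair to `±1`, so motion is
never tangential, and a convex body meets a transversal chord in exactly one further boundary point.
-/

open scoped Pointwise Topology

/-- `K` is the closed unit body of a norm. -/
structure IsNormBody {n : ℕ} (K : Set (Fin n → ℝ)) : Prop where
  convex : Convex ℝ K
  mem_nhds : K ∈ 𝓝 (0 : Fin n → ℝ)
  symm : ∀ x ∈ K, -x ∈ K
  closed : IsClosed K
  gauge_pos : ∀ x, x ≠ 0 → 0 < gauge K x

namespace IsNormBody

variable {n : ℕ} {K : Set (Fin n → ℝ)}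

theorem absorbent (h : IsNormBody K) : Absorbent ℝ K := absorbent_nhds_zero h.mem_nhds

theorem gauge_add_le (h : IsNormBody K) (x y : Fin n → ℝ) :
    gauge K (x + y) ≤ gauge K x + gauge K y := _root_.gauge_add_le h.convex h.absorbent x y

theorem gauge_neg (h : IsNormBody K) (x : Fin n → ℝ) : gauge K (-x) = gauge K x :=
  _root_.gauge_neg h.symm x

theorem gauge_le_one_iff (h : IsNormBody K) {x : Fin n → ℝ} : gauge K x ≤ 1 ↔ x ∈ K := by
  rw [gauge_le_one_iff_mem_closure h.convex h.mem_nhds, h.closed.closure_eq]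

theorem mem_frontier_iff (h : IsNormBody K) {x : Fin n → ℝ} : x ∈ frontier K ↔ gauge K x = 1 :=
  (gauge_eq_one_iff_mem_frontier h.convex h.mem_nhds).symm

theorem continuous_gauge (h : IsNormBody K) : Continuous (gauge K) :=
  _root_.continuous_gauge h.convex h.mem_nhds

end IsNormBody

theorem gauge_smul_nonneg {n : ℕ} (K : Set (Fin n → ℝ)) {c : ℝ} (hc : 0 ≤ c) (x : Fin n → ℝ) :
    gauge K (c • x) = c * gauge K x := by
  rw [gauge_smul_of_nonneg hc, smul_eq_mul]

/-- The sublevel set of a norm is a norm body with this norm as its gauge. -/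
theorem gauge_setOf_le_one {n : ℕ} {f : (Fin n → ℝ) → ℝ}
    (hsmul : ∀ c : ℝ, 0 ≤ c → ∀ x, f (c • x) = c * f x) (hpos : ∀ x, x ≠ 0 → 0 < f x) :
    gauge {x | f x ≤ 1} = f := by
  have h0 : f 0 = 0 := by simpa using hsmul 0 le_rfl 0
  have key : ∀ r : ℝ, 0 < r → ∀ x, (x ∈ r • {x | f x ≤ 1} ↔ f x ≤ r) := by
    intro r hr x
    rw [Set.mem_smul_set_iff_inv_smul_mem₀ hr.ne', Set.mem_ofPred_eq, hsmul _ (by positivity),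
      inv_mul_le_iff₀ hr, mul_one]
  ext x
  by_cases hx : x = 0
  · rw [hx, gauge_zero, h0]
  have hfx := hpos x hx
  apply le_antisymm
  · exact gauge_le_of_mem hfx.le ((key _ hfx x).2 le_rfl)
  · refine le_csInf (s := {r | 0 < r ∧ _}) ⟨f x, hfx, (key _ hfx x).2 le_rfl⟩ ?_
    rintro r ⟨hr, hxr⟩
    exact (key r hr x).1 hxr

theorem isNormBody_setOf_le_one {n : ℕ} {f : (Fin n → ℝ) → ℝ}
    (hsmul : ∀ c : ℝ, 0 ≤ c → ∀ x, f (c • x) = c * f x) (hpos : ∀ x, x ≠ 0 → 0 < f x)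
    (hadd : ∀ x y, f (x + y) ≤ f x + f y) (hneg : ∀ x, f (-x) = f x) (hcont : Continuous f) :
    IsNormBody {x | f x ≤ 1} where
  convex := by
    intro x hx y hy a b ha hb hab
    simp only [Set.mem_ofPred_eq] at *
    calc f (a • x + b • y) ≤ a * f x + b * f y := by
          rw [← hsmul a ha, ← hsmul b hb]; exact hadd _ _
      _ ≤ a * 1 + b * 1 := by gcongr
      _ = 1 := by linarith
  mem_nhds := by
    have h0 : f 0 = 0 := by simpa using hsmul 0 le_rfl 0
    have : ∀ᶠ x in 𝓝 0, f x < 1 := hcont.continuousAt.eventually_lt continuousAt_const (by simp [h0])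
    filter_upwards [this] with x hx using hx.le
  symm := fun x hx => by simpa [hneg] using hx
  closed := isClosed_le hcont continuous_const
  gauge_pos := by rw [gauge_setOf_le_one hsmul hpos]; exact hpos

/-! ### Splitting `ℝ^(k+l)` into blocks, and the norms of the two sums. -/

section Parts

variable {k l : ℕ}

@[simp] theorem firstPart_append (x : Fin k → ℝ) (y : Fin l → ℝ) :
    firstPart (Fin.append x y) = x := by ext i; simp [firstPart]

@[simp] theorem lastPart_append (x : Fin k → ℝ) (y : Fin l → ℝ) :
    lastPart (Fin.append x y) = y := by ext i; simp [lastPart]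

@[simp] theorem append_parts (z : Fin (k + l) → ℝ) :
    Fin.append (firstPart z) (lastPart z) = z := by
  ext i; refine Fin.addCases (fun i => ?_) (fun i => ?_) i <;> simp [firstPart, lastPart]

theorem parts_ext {z w : Fin (k + l) → ℝ} (h₁ : firstPart z = firstPart w)
    (h₂ : lastPart z = lastPart w) : z = w := by
  rw [← append_parts z, h₁, h₂, append_parts]

theorem dotProduct_parts (z w : Fin (k + l) → ℝ) :
    dotProduct z w = dotProduct (firstPart z) (firstPart w) +
      dotProduct (lastPart z) (lastPart w) := by
  simp [dotProduct, Fin.sum_univ_add, firstPart, lastPart]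

@[simp] theorem firstPart_add (z w : Fin (k + l) → ℝ) :
    firstPart (z + w) = firstPart z + firstPart w := rfl
@[simp] theorem lastPart_add (z w : Fin (k + l) → ℝ) :
    lastPart (z + w) = lastPart z + lastPart w := rfl
@[simp] theorem firstPart_sub (z w : Fin (k + l) → ℝ) :
    firstPart (z - w) = firstPart z - firstPart w := rfl
@[simp] theorem lastPart_sub (z w : Fin (k + l) → ℝ) :
    lastPart (z - w) = lastPart z - lastPart w := rfl
@[simp] theorem firstPart_neg (z : Fin (k + l) → ℝ) : firstPart (-z) = -firstPart z := rfl
@[simp] theorem lastPart_neg (z : Fin (k + l) → ℝ) : lastPart (-z) = -lastPart z := rfl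
@[simp] theorem firstPart_smul (c : ℝ) (z : Fin (k + l) → ℝ) :
    firstPart (c • z) = c • firstPart z := rfl
@[simp] theorem lastPart_smul (c : ℝ) (z : Fin (k + l) → ℝ) :
    lastPart (c • z) = c • lastPart z := rfl

theorem continuous_firstPart : Continuous (firstPart : (Fin (k + l) → ℝ) → Fin k → ℝ) :=
  continuous_pi fun _ => continuous_apply _

theorem continuous_lastPart : Continuous (lastPart : (Fin (k + l) → ℝ) → Fin l → ℝ) :=
  continuous_pi fun _ => continuous_apply _

theorem parts_ne_zero {z : Fin (k + l) → ℝ} (hz : z ≠ 0) : firstPart z ≠ 0 ∨ lastPart z ≠ 0 := by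
  by_contra! h
  exact hz (parts_ext h.1 h.2)

variable {K : Set (Fin k → ℝ)} {L : Set (Fin l → ℝ)}

theorem gauge_oplus_and_isNormBody (hK : IsNormBody K) (hL : IsNormBody L) :
    (gauge (oplusOne K L) = fun x => gauge K (firstPart x) + gauge L (lastPart x)) ∧
    (gauge (oplusInf K L) = fun x => max (gauge K (firstPart x)) (gauge L (lastPart x))) ∧
    IsNormBody (oplusOne K L) ∧ IsNormBody (oplusInf K L) := by
  have s1 : ∀ c : ℝ, 0 ≤ c → ∀ x : Fin (k + l) → ℝ,
      gauge K (firstPart (c • x)) + gauge L (lastPart (c • x)) =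
        c * (gauge K (firstPart x) + gauge L (lastPart x)) := by
    intro c hc x
    simp [gauge_smul_nonneg _ hc, mul_add]
  have s2 : ∀ c : ℝ, 0 ≤ c → ∀ x : Fin (k + l) → ℝ,
      max (gauge K (firstPart (c • x))) (gauge L (lastPart (c • x))) =
        c * max (gauge K (firstPart x)) (gauge L (lastPart x)) := by
    intro c hc x
    simp [gauge_smul_nonneg _ hc, mul_max_of_nonneg _ _ hc]
  have p1 : ∀ x : Fin (k + l) → ℝ, x ≠ 0 →
      0 < gauge K (firstPart x) + gauge L (lastPart x) := by
    intro x hx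
    rcases parts_ne_zero hx with h | h
    · exact add_pos_of_pos_of_nonneg (hK.gauge_pos _ h) (gauge_nonneg _)
    · exact add_pos_of_nonneg_of_pos (gauge_nonneg _) (hL.gauge_pos _ h)
  have p2 : ∀ x : Fin (k + l) → ℝ, x ≠ 0 →
      0 < max (gauge K (firstPart x)) (gauge L (lastPart x)) := by
    intro x hx
    rcases parts_ne_zero hx with h | h
    · exact lt_max_of_lt_left (hK.gauge_pos _ h)
    · exact lt_max_of_lt_right (hL.gauge_pos _ h)
  have c1 := hK.continuous_gauge.comp (continuous_firstPart (l := l))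
  have c2 := hL.continuous_gauge.comp (continuous_lastPart (k := k))
  refine ⟨gauge_setOf_le_one s1 p1, gauge_setOf_le_one s2 p2,
    isNormBody_setOf_le_one s1 p1 ?_ ?_ (c1.add c2), isNormBody_setOf_le_one s2 p2 ?_ ?_ (c1.max c2)⟩
  · intro x y
    have := hK.gauge_add_le (firstPart x) (firstPart y)
    have := hL.gauge_add_le (lastPart x) (lastPart y)
    simp only [firstPart_add, lastPart_add]; linarith
  · intro x; simp [hK.gauge_neg, hL.gauge_neg]
  · intro x y
    refine max_le ?_ ?_
    · exact (hK.gauge_add_le _ _).trans (add_le_add (le_max_left _ _) (le_max_left _ _))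
    · exact (hL.gauge_add_le _ _).trans (add_le_add (le_max_right _ _) (le_max_right _ _))
  · intro x; simp [hK.gauge_neg, hL.gauge_neg]

theorem gauge_oplusOne (hK : IsNormBody K) (hL : IsNormBody L) (x : Fin (k + l) → ℝ) :
    gauge (oplusOne K L) x = gauge K (firstPart x) + gauge L (lastPart x) :=
  congrFun (gauge_oplus_and_isNormBody hK hL).1 x

theorem gauge_oplusInf (hK : IsNormBody K) (hL : IsNormBody L) (x : Fin (k + l) → ℝ) :
    gauge (oplusInf K L) x = max (gauge K (firstPart x)) (gauge L (lastPart x)) :=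
  congrFun (gauge_oplus_and_isNormBody hK hL).2.1 x

theorem IsNormBody.oplusOne (hK : IsNormBody K) (hL : IsNormBody L) :
    IsNormBody (oplusOne K L) := (gauge_oplus_and_isNormBody hK hL).2.2.1

theorem IsNormBody.oplusInf (hK : IsNormBody K) (hL : IsNormBody L) :
    IsNormBody (oplusInf K L) := (gauge_oplus_and_isNormBody hK hL).2.2.2

end Parts

section Segment

theorem mem_segment_iff {x : Fin 1 → ℝ} : x ∈ Set.Icc (-1 : Fin 1 → ℝ) 1 ↔ |x 0| ≤ 1 := by
  simp [Set.mem_Icc, Pi.le_def, abs_le]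

theorem segment_eq : Set.Icc (-1 : Fin 1 → ℝ) 1 = {x | |x 0| ≤ 1} :=
  Set.ext fun _ => mem_segment_iff

theorem abs_apply_zero_pos {x : Fin 1 → ℝ} (hx : x ≠ 0) : 0 < |x 0| := by
  rw [abs_pos]
  intro h
  apply hx
  ext i
  rw [Subsingleton.elim i 0, h]; rfl

theorem gauge_segment (x : Fin 1 → ℝ) : gauge (Set.Icc (-1 : Fin 1 → ℝ) 1) x = |x 0| := by
  rw [segment_eq]
  refine congrFun (gauge_setOf_le_one (f := fun x : Fin 1 → ℝ => |x 0|) ?_ ?_) x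
  · intro c hc x; simp [abs_mul, abs_of_nonneg hc]
  · exact fun x hx => abs_apply_zero_pos hx

theorem isNormBody_segment : IsNormBody (Set.Icc (-1 : Fin 1 → ℝ) 1) := by
  rw [segment_eq]
  refine isNormBody_setOf_le_one (f := fun x : Fin 1 → ℝ => |x 0|) ?_ ?_ ?_ ?_ ?_
  · intro c hc x; simp [abs_mul, abs_of_nonneg hc]
  · exact fun x hx => abs_apply_zero_pos hx
  · intro x y; exact abs_add_le _ _
  · intro x; simp
  · fun_prop

theorem polarBody_segment :
    polarBody (Set.Icc (-1 : Fin 1 → ℝ) 1) = Set.Icc (-1 : Fin 1 → ℝ) 1 := by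
  ext p
  rw [mem_segment_iff]
  constructor
  · intro h
    have h1 := h 1 (by rw [mem_segment_iff]; simp)
    have h2 := h (-1) (by rw [mem_segment_iff]; simp)
    simp [dotProduct] at h1 h2
    rw [abs_le]; constructor <;> linarith
  · intro h x hx
    rw [mem_segment_iff] at hx
    simp only [dotProduct, Finset.univ_unique, Fin.default_eq_zero, Finset.sum_singleton]
    calc p 0 * x 0 ≤ |p 0 * x 0| := le_abs_self _
      _ = |p 0| * |x 0| := abs_mul _ _
      _ ≤ 1 * 1 := by gcongr
      _ = 1 := one_mul 1

end Segment

/-! ### Polarity exchanges the two sums. -/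

section Polar

variable {n k l : ℕ}

/-- The norm of the polar is the support function; this is the half of that fact which turns a bound
on all of `K` into a bound on the norm. For `c = 0` no positive dilation is at hand, whence the
detour through `c + ε`. -/
theorem gauge_polarBody_le {K : Set (Fin n → ℝ)} {p : Fin n → ℝ} {c : ℝ} (hc : 0 ≤ c)
    (h : ∀ x ∈ K, dotProduct p x ≤ c) : gauge (polarBody K) p ≤ c := by
  have key : ∀ r : ℝ, 0 < r → (∀ x ∈ K, dotProduct p x ≤ r) → gauge (polarBody K) p ≤ r := by
    intro r hr hx
    apply gauge_le_of_mem hr.le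
    rw [Set.mem_smul_set_iff_inv_smul_mem₀ hr.ne']
    intro x hxK
    rw [smul_dotProduct, smul_eq_mul, inv_mul_le_iff₀ hr, mul_one]
    exact hx x hxK
  apply le_of_forall_pos_le_add
  intro ε hε
  exact key _ (by linarith) fun x hx => (h x hx).trans (by linarith)

theorem dotProduct_le_gauge {K : Set (Fin n → ℝ)} (hK : IsNormBody K) {p : Fin n → ℝ}
    (hp : p ∈ polarBody K) (x : Fin n → ℝ) : dotProduct p x ≤ gauge K x := by
  by_cases hx : x = 0
  · simp [hx]
  have hpos := hK.gauge_pos x hx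
  have : (gauge K x)⁻¹ • x ∈ K := by
    rw [← hK.gauge_le_one_iff, gauge_smul_nonneg _ (by positivity), inv_mul_cancel₀ hpos.ne']
  have := hp _ this
  rw [dotProduct_smul, smul_eq_mul, inv_mul_le_iff₀ hpos, mul_one] at this
  exact this

theorem dotProduct_le_gauge_polarBody {K : Set (Fin n → ℝ)} (hT : IsNormBody (polarBody K))
    (p : Fin n → ℝ) {x : Fin n → ℝ} (hx : x ∈ K) : dotProduct p x ≤ gauge (polarBody K) p := by
  refine dotProduct_comm p x ▸ dotProduct_le_gauge hT (p := x) ?_ p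
  intro q hq
  rw [dotProduct_comm]
  exact hq x hx

variable {K : Set (Fin k → ℝ)} {L : Set (Fin l → ℝ)}

theorem polarBody_oplusOne (hK : IsNormBody K) (hL : IsNormBody L)
    (hK' : IsNormBody (polarBody K)) (hL' : IsNormBody (polarBody L)) :
    polarBody (oplusOne K L) = oplusInf (polarBody K) (polarBody L) := by
  ext p
  simp only [oplusInf, Set.mem_ofPred_eq, max_le_iff, hK'.gauge_le_one_iff, hL'.gauge_le_one_iff]
  constructor
  · intro h
    constructor
    · intro x hx
      have := h (Fin.append x 0) (by simpa [oplusOne] using hK.gauge_le_one_iff.2 hx)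
      simpa [dotProduct_parts] using this
    · intro x hx
      have := h (Fin.append 0 x) (by simpa [oplusOne] using hL.gauge_le_one_iff.2 hx)
      simpa [dotProduct_parts] using this
  · rintro ⟨h1, h2⟩ x hx
    rw [dotProduct_parts]
    have := dotProduct_le_gauge hK h1 (firstPart x)
    have := dotProduct_le_gauge hL h2 (lastPart x)
    have : gauge K (firstPart x) + gauge L (lastPart x) ≤ 1 := hx
    linarith

theorem polarBody_oplusInf (hK : IsNormBody K) (hL : IsNormBody L)
    (hK' : IsNormBody (polarBody K)) (hL' : IsNormBody (polarBody L)) :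
    polarBody (oplusInf K L) = oplusOne (polarBody K) (polarBody L) := by
  ext p
  simp only [oplusOne, Set.mem_ofPred_eq]
  constructor
  · intro h
    have h1 : ∀ x ∈ K, ∀ y ∈ L, dotProduct (firstPart p) x + dotProduct (lastPart p) y ≤ 1 := by
      intro x hx y hy
      have := h (Fin.append x y)
        (by simpa [oplusInf] using ⟨hK.gauge_le_one_iff.2 hx, hL.gauge_le_one_iff.2 hy⟩)
      simpa [dotProduct_parts] using this
    have h0K : (0 : Fin k → ℝ) ∈ K := mem_of_mem_nhds hK.mem_nhds
    have h0L : (0 : Fin l → ℝ) ∈ L := mem_of_mem_nhds hL.mem_nhds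
    -- The suprema over `x` and `y` are taken one after the other. Testing with the origin provides
    -- the nonnegativity of the bounds.
    have h2 : ∀ y ∈ L, gauge (polarBody K) (firstPart p) ≤ 1 - dotProduct (lastPart p) y := by
      intro y hy
      apply gauge_polarBody_le
      · have := h1 0 h0K y hy
        rw [dotProduct_zero] at this; linarith
      · intro x hx
        linarith [h1 x hx y hy]
    have h3 : gauge (polarBody L) (lastPart p) ≤ 1 - gauge (polarBody K) (firstPart p) := by
      apply gauge_polarBody_le
      · have := h2 0 h0L
        rw [dotProduct_zero] at this; linarith
      · intro y hy
        linarith [h2 y hy]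
    linarith
  · intro h x hx
    have hx' : gauge K (firstPart x) ≤ 1 ∧ gauge L (lastPart x) ≤ 1 := by
      simpa [oplusInf] using hx
    rw [dotProduct_parts]
    have := dotProduct_le_gauge_polarBody hK' (firstPart p) (hK.gauge_le_one_iff.1 hx'.1)
    have := dotProduct_le_gauge_polarBody hL' (lastPart p) (hL.gauge_le_one_iff.1 hx'.2)
    linarith

end Polar

/-! ### Hanner polytopes are closed under polarity, and the bipolar theorem holds for them. -/

namespace IsHanner

theorem isNormBody {n : ℕ} {K : Set (Fin n → ℝ)} (h : IsHanner n K) : IsNormBody K := by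
  induction h with
  | segment => exact isNormBody_segment
  | sumOne _ _ h₁ h₂ => exact h₁.oplusOne h₂
  | sumInf _ _ h₁ h₂ => exact h₁.oplusInf h₂

theorem polarBody {n : ℕ} {K : Set (Fin n → ℝ)} (h : IsHanner n K) :
    IsHanner n (polarBody K) := by
  induction h with
  | segment => rw [polarBody_segment]; exact .segment
  | sumOne hK hL h₁ h₂ =>
    rw [polarBody_oplusOne hK.isNormBody hL.isNormBody h₁.isNormBody h₂.isNormBody]
    exact .sumInf h₁ h₂
  | sumInf hK hL h₁ h₂ =>
    rw [polarBody_oplusInf hK.isNormBody hL.isNormBody h₁.isNormBody h₂.isNormBody]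
    exact .sumOne h₁ h₂

theorem polarBody_oplusOne {k l : ℕ} {K : Set (Fin k → ℝ)} {L : Set (Fin l → ℝ)}
    (hK : IsHanner k K) (hL : IsHanner l L) :
    _root_.polarBody (oplusOne K L) = oplusInf (_root_.polarBody K) (_root_.polarBody L) :=
  _root_.polarBody_oplusOne hK.isNormBody hL.isNormBody hK.polarBody.isNormBody
    hL.polarBody.isNormBody

theorem polarBody_oplusInf {k l : ℕ} {K : Set (Fin k → ℝ)} {L : Set (Fin l → ℝ)}
    (hK : IsHanner k K) (hL : IsHanner l L) :
    _root_.polarBody (oplusInf K L) = oplusOne (_root_.polarBody K) (_root_.polarBody L) :=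
  _root_.polarBody_oplusInf hK.isNormBody hL.isNormBody hK.polarBody.isNormBody
    hL.polarBody.isNormBody

theorem polarBody_polarBody {n : ℕ} {K : Set (Fin n → ℝ)} (h : IsHanner n K) :
    _root_.polarBody (_root_.polarBody K) = K := by
  induction h with
  | segment => rw [polarBody_segment, polarBody_segment]
  | sumOne hK hL h₁ h₂ =>
    rw [hK.polarBody_oplusOne hL, hK.polarBody.polarBody_oplusInf hL.polarBody, h₁, h₂]
  | sumInf hK hL h₁ h₂ =>
    rw [hK.polarBody_oplusInf hL, hK.polarBody.polarBody_oplusOne hL.polarBody, h₁, h₂]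

/-- `K ⊕_∞ L` is the polar of `K° ⊕₁ L°`. -/
theorem oplusInf_eq {k l : ℕ} {K : Set (Fin k → ℝ)} {L : Set (Fin l → ℝ)}
    (hK : IsHanner k K) (hL : IsHanner l L) :
    oplusInf K L = _root_.polarBody (oplusOne (_root_.polarBody K) (_root_.polarBody L)) := by
  rw [hK.polarBody.polarBody_oplusOne hL.polarBody, hK.polarBody_polarBody, hL.polarBody_polarBody]

theorem pos {n : ℕ} {K : Set (Fin n → ℝ)} (h : IsHanner n K) : 0 < n := by
  induction h with
  | segment => exact one_pos
  | sumOne _ _ h₁ _ => omega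
  | sumInf _ _ h₁ _ => omega

end IsHanner

open scoped Topology
/-! ### Outer normals -/

/-- The continuous linear functional `v ↦ ⟨w, v⟩`. -/
noncomputable def dotCLM {n : ℕ} (w : Fin n → ℝ) : (Fin n → ℝ) →L[ℝ] ℝ :=
  LinearMap.toContinuousLinearMap
    { toFun := fun v => dotProduct w v
      map_add' := dotProduct_add w
      map_smul' := fun c v => dotProduct_smul c w v }

@[simp] theorem dotCLM_apply {n : ℕ} (w v : Fin n → ℝ) : dotCLM w v = dotProduct w v := rfl

theorem dotCLM_injective {n : ℕ} : Function.Injective (dotCLM (n := n)) := by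
  intro w w' h
  ext i
  simpa using DFunLike.congr_fun h (Pi.single i 1)

/-- `w` is the differential at `x` of the norm with unit body `K`. -/
def HasNormal {n : ℕ} (K : Set (Fin n → ℝ)) (x w : Fin n → ℝ) : Prop :=
  HasFDerivAt (gauge K) (dotCLM w) x

theorem hasNormal_outerNormal {n : ℕ} {K : Set (Fin n → ℝ)} {x : Fin n → ℝ}
    (h : DifferentiableAt ℝ (gauge K) x) : HasNormal K x (outerNormal K x) := by
  have : dotCLM (outerNormal K x) = fderiv ℝ (gauge K) x := by
    refine ContinuousLinearMap.ext fun v => ?_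
    have hv : v = ∑ i, v i • (Pi.single i 1 : Fin n → ℝ) := by
      simpa [Pi.single_apply] using (pi_eq_sum_univ' v)
    conv_rhs => rw [hv]
    simp [outerNormal, dotProduct, mul_comm]
  rw [HasNormal, this]
  exact h.hasFDerivAt

namespace HasNormal

variable {n : ℕ} {K : Set (Fin n → ℝ)} {x w : Fin n → ℝ}

theorem unique (h : HasNormal K x w) {w' : Fin n → ℝ} (h' : HasNormal K x w') : w = w' :=
  dotCLM_injective (HasFDerivAt.unique h h')

theorem differentiableAt (h : HasNormal K x w) : DifferentiableAt ℝ (gauge K) x :=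
  HasFDerivAt.differentiableAt h

theorem outerNormal_eq (h : HasNormal K x w) : outerNormal K x = w :=
  (hasNormal_outerNormal h.differentiableAt).unique h

theorem hasDerivAt (h : HasNormal K x w) (d : Fin n → ℝ) :
    HasDerivAt (fun t : ℝ => gauge K (x + t • d)) (dotProduct w d) 0 := by
  have h1 : HasDerivAt (fun t : ℝ => x + t • d) d 0 := by
    simpa using ((hasDerivAt_id (0 : ℝ)).smul_const d).const_add x
  have h2 : HasFDerivAt (gauge K) (dotCLM w) (x + (0 : ℝ) • d) := by
    rw [zero_smul, add_zero]; exact h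
  exact h2.comp_hasDerivAt (0 : ℝ) h1

/-- Euler's identity for a function homogeneous of degree one. -/
theorem dotProduct_self (h : HasNormal K x w) : dotProduct w x = gauge K x := by
  have h1 := h.hasDerivAt x
  have h2 : HasDerivAt (fun t : ℝ => (1 + t) * gauge K x) (gauge K x) 0 := by
    simpa using ((hasDerivAt_id (0 : ℝ)).const_add 1).mul_const (gauge K x)
  refine h1.unique (h2.congr_of_eventuallyEq ?_)
  filter_upwards [lt_mem_nhds (show (-1 : ℝ) < 0 by norm_num)] with t ht
  rw [← gauge_smul_nonneg K (by linarith), add_smul, one_smul]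

theorem smul (h : HasNormal K x w) {c : ℝ} (hc : 0 < c) : HasNormal K (c • x) w := by
  have h2 : HasFDerivAt (gauge K) (dotCLM w) (c⁻¹ • (c • x)) := by
    rw [inv_smul_smul₀ hc.ne']; exact h
  have h3 := (h2.comp (c • x) ((hasFDerivAt_id (c • x)).const_smul c⁻¹)).const_smul c
  unfold HasNormal
  convert! h3 using 1
  · ext y
    simp only [Pi.smul_apply, Function.comp]
    rw [gauge_smul_nonneg K (by positivity), smul_eq_mul, mul_inv_cancel_left₀ hc.ne']
  · ext i
    simp [hc.ne']

theorem neg (hK : IsNormBody K) (h : HasNormal K x w) : HasNormal K (-x) (-w) := by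
  have h2 : HasFDerivAt (gauge K) (dotCLM w) (-(-x)) := by rw [neg_neg]; exact h
  have h3 := h2.comp (-x) (hasFDerivAt_id (-x)).neg
  unfold HasNormal
  convert! h3 using 1
  · ext y
    simp [hK.gauge_neg]
  · ext i
    simp

theorem dotProduct_le (hK : IsNormBody K) (h : HasNormal K x w) (y : Fin n → ℝ) :
    dotProduct w y ≤ gauge K y := by
  refine le_of_tendsto (h.hasDerivAt y).tendsto_slope_zero_right ?_
  filter_upwards [self_mem_nhdsWithin] with t ht
  have ht : 0 < t := ht
  have := hK.gauge_add_le x (t • y)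
  rw [gauge_smul_nonneg K ht.le] at this
  simp only [zero_add, zero_smul, add_zero, smul_eq_mul]
  rw [inv_mul_le_iff₀ ht]
  linarith

theorem mem_polarBody (hK : IsNormBody K) (h : HasNormal K x w) : w ∈ polarBody K :=
  fun y hy => (h.dotProduct_le hK y).trans (gauge_le_one_of_mem hy)

/-- A norm has a kink at the origin. By symmetry the derivatives along `z` and `-z` agree, so they
vanish, while the one-sided derivative along `z` is the norm of `z`. -/
theorem ne_zero (hn : 0 < n) (hK : IsNormBody K) (h : HasNormal K x w) : x ≠ 0 := by
  rintro rfl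
  set z : Fin n → ℝ := fun _ => 1
  have hz : z ≠ 0 := fun h0 => one_ne_zero (congrFun h0 ⟨0, hn⟩)
  have hg := hK.gauge_pos z hz
  have h1 := h.hasDerivAt z
  have h2 := h.hasDerivAt (-z)
  have heq : ∀ t : ℝ, gauge K (0 + t • (-z)) = gauge K (0 + t • z) := by
    intro t; rw [zero_add, zero_add, smul_neg, hK.gauge_neg]
  simp only [heq] at h2
  have h3 := h1.unique h2
  rw [dotProduct_neg] at h3
  have h4 : HasDerivWithinAt (fun t : ℝ => t * gauge K z) (1 * gauge K z) (Set.Ici 0) 0 :=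
    ((hasDerivAt_id (0 : ℝ)).mul_const (gauge K z)).hasDerivWithinAt
  have h5 := (h1.hasDerivWithinAt (s := Set.Ici 0)).congr_of_eventuallyEq
    (f₁ := fun t : ℝ => t * gauge K z) ?_ (by simp)
  · have h6 := (uniqueDiffOn_Ici (0 : ℝ) 0 Set.self_mem_Ici).eq_deriv _ h4 h5
    linarith
  · filter_upwards [self_mem_nhdsWithin] with t ht
    rw [zero_add, gauge_smul_nonneg K ht]

theorem ne_zero' (hx : 0 < gauge K x) (h : HasNormal K x w) : w ≠ 0 := by
  rintro rfl
  have := h.dotProduct_self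
  rw [zero_dotProduct] at this
  linarith

end HasNormal

/-! ### Normals of the two sums in terms of the normals of the summands. -/

section Sums

variable {k l : ℕ} {K : Set (Fin k → ℝ)} {L : Set (Fin l → ℝ)}

/-- `firstPart` as a continuous linear map. -/
noncomputable def firstCLM (k l : ℕ) : (Fin (k + l) → ℝ) →L[ℝ] (Fin k → ℝ) :=
  LinearMap.toContinuousLinearMap
    { toFun := firstPart, map_add' := fun _ _ => rfl, map_smul' := fun _ _ => rfl }

/-- `lastPart` as a continuous linear map. -/
noncomputable def lastCLM (k l : ℕ) : (Fin (k + l) → ℝ) →L[ℝ] (Fin l → ℝ) :=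
  LinearMap.toContinuousLinearMap
    { toFun := lastPart, map_add' := fun _ _ => rfl, map_smul' := fun _ _ => rfl }

/-- The embedding of `ℝᵏ` as the first summand. -/
noncomputable def inlCLM (k l : ℕ) : (Fin k → ℝ) →L[ℝ] (Fin (k + l) → ℝ) :=
  LinearMap.toContinuousLinearMap
    { toFun := fun x => Fin.append x 0
      map_add' := fun x y => parts_ext (by simp) (by simp)
      map_smul' := fun c x => parts_ext (by simp) (by simp) }

/-- The embedding of `ℝˡ` as the last summand. -/
noncomputable def inrCLM (k l : ℕ) : (Fin l → ℝ) →L[ℝ] (Fin (k + l) → ℝ) :=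
  LinearMap.toContinuousLinearMap
    { toFun := fun x => Fin.append 0 x
      map_add' := fun x y => parts_ext (by simp) (by simp)
      map_smul' := fun c x => parts_ext (by simp) (by simp) }

@[simp] theorem firstCLM_apply (z : Fin (k + l) → ℝ) : firstCLM k l z = firstPart z := rfl
@[simp] theorem lastCLM_apply (z : Fin (k + l) → ℝ) : lastCLM k l z = lastPart z := rfl
@[simp] theorem inlCLM_apply (x : Fin k → ℝ) : inlCLM k l x = Fin.append x 0 := rfl
@[simp] theorem inrCLM_apply (x : Fin l → ℝ) : inrCLM k l x = Fin.append 0 x := rfl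

theorem dotCLM_comp_inl (w : Fin (k + l) → ℝ) :
    (dotCLM w).comp (inlCLM k l) = dotCLM (firstPart w) := by
  refine ContinuousLinearMap.ext fun v => ?_
  simp [dotProduct_parts]

theorem dotCLM_comp_inr (w : Fin (k + l) → ℝ) :
    (dotCLM w).comp (inrCLM k l) = dotCLM (lastPart w) := by
  refine ContinuousLinearMap.ext fun v => ?_
  simp [dotProduct_parts]

theorem dotCLM_eq_parts (w : Fin (k + l) → ℝ) :
    dotCLM w = (dotCLM (firstPart w)).comp (firstCLM k l) +
      (dotCLM (lastPart w)).comp (lastCLM k l) := by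
  refine ContinuousLinearMap.ext fun v => ?_
  simp [dotProduct_parts]

theorem HasFDerivAt.append_left {f : (Fin (k + l) → ℝ) → ℝ} {z w : Fin (k + l) → ℝ}
    (h : HasFDerivAt f (dotCLM w) z) :
    HasFDerivAt (fun x => f (Fin.append x (lastPart z))) (dotCLM (firstPart w)) (firstPart z) := by
  have h1 : HasFDerivAt (fun x => inlCLM k l x + Fin.append 0 (lastPart z)) (inlCLM k l)
    (firstPart z) := (inlCLM k l).hasFDerivAt.add_const _
  have e : ∀ x, inlCLM k l x + Fin.append 0 (lastPart z) = Fin.append x (lastPart z) :=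
    fun x => parts_ext (by simp) (by simp)
  simp only [e] at h1
  rw [← append_parts z] at h
  have := h.comp (firstPart z) (f := fun x => Fin.append x (lastPart z)) h1
  rwa [dotCLM_comp_inl] at this

theorem HasFDerivAt.append_right {f : (Fin (k + l) → ℝ) → ℝ} {z w : Fin (k + l) → ℝ}
    (h : HasFDerivAt f (dotCLM w) z) :
    HasFDerivAt (fun y => f (Fin.append (firstPart z) y)) (dotCLM (lastPart w)) (lastPart z) := by
  have h1 : HasFDerivAt (fun x => inrCLM k l x + Fin.append (firstPart z) 0) (inrCLM k l)
    (lastPart z) := (inrCLM k l).hasFDerivAt.add_const _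
  have e : ∀ x, inrCLM k l x + Fin.append (firstPart z) 0 = Fin.append (firstPart z) x :=
    fun x => parts_ext (by simp) (by simp)
  simp only [e] at h1
  rw [← append_parts z] at h
  have := h.comp (lastPart z) (f := fun x => Fin.append (firstPart z) x) h1
  rwa [dotCLM_comp_inr] at this

theorem hasNormal_oplusOne (hK : IsNormBody K) (hL : IsNormBody L) {z w : Fin (k + l) → ℝ} :
    HasNormal (oplusOne K L) z w ↔
      HasNormal K (firstPart z) (firstPart w) ∧ HasNormal L (lastPart z) (lastPart w) := by
  have hg : gauge (oplusOne K L) = fun x => gauge K (firstPart x) + gauge L (lastPart x) :=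
    funext (gauge_oplusOne hK hL)
  unfold HasNormal
  rw [hg]
  constructor
  · intro h
    constructor
    · have := h.append_left
      simp only [firstPart_append, lastPart_append] at this
      simpa using this.sub_const (gauge L (lastPart z))
    · have := h.append_right
      simp only [firstPart_append, lastPart_append] at this
      simpa using this.sub_const (gauge K (firstPart z))
  · rintro ⟨h1, h2⟩
    rw [dotCLM_eq_parts]
    exact (h1.comp z (firstCLM k l).hasFDerivAt).add (h2.comp z (lastCLM k l).hasFDerivAt)

theorem hasNormal_oplusInf_left (hK : IsNormBody K) (hL : IsNormBody L) {z w : Fin (k + l) → ℝ}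
    (hlt : gauge L (lastPart z) < gauge K (firstPart z)) :
    HasNormal (oplusInf K L) z w ↔ HasNormal K (firstPart z) (firstPart w) ∧ lastPart w = 0 := by
  have hg : gauge (oplusInf K L) = fun x => max (gauge K (firstPart x)) (gauge L (lastPart x)) :=
    funext (gauge_oplusInf hK hL)
  unfold HasNormal
  rw [hg]
  constructor
  · intro h
    constructor
    · have := h.append_left
      simp only [firstPart_append, lastPart_append] at this
      refine this.congr_of_eventuallyEq ?_
      filter_upwards [hK.continuous_gauge.continuousAt.eventually_const_lt hlt] with x hx
      exact (max_eq_left hx.le).symm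
    · have := h.append_right
      simp only [firstPart_append, lastPart_append] at this
      have h2 : HasFDerivAt (fun _ : Fin l → ℝ => gauge K (firstPart z)) (dotCLM (lastPart w))
          (lastPart z) := by
        refine this.congr_of_eventuallyEq ?_
        filter_upwards [hL.continuous_gauge.continuousAt.eventually_lt_const hlt] with x hx
        exact (max_eq_left hx.le).symm
      have h3 := h2.unique (hasFDerivAt_const _ _)
      apply dotCLM_injective
      rw [h3]
      refine ContinuousLinearMap.ext fun v => ?_
      simp
  · rintro ⟨h1, h2⟩
    rw [dotCLM_eq_parts, h2]
    have h3 := h1.comp z (firstCLM k l).hasFDerivAt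
    have h4 : dotCLM (0 : Fin l → ℝ) = 0 := ContinuousLinearMap.ext fun v => by simp
    rw [h4, ContinuousLinearMap.zero_comp, add_zero]
    refine h3.congr_of_eventuallyEq ?_
    have c1 := (hK.continuous_gauge.comp (continuous_firstPart (l := l))).continuousAt (x := z)
    have c2 := (hL.continuous_gauge.comp (continuous_lastPart (k := k))).continuousAt (x := z)
    filter_upwards [c2.eventually_lt c1 hlt] with x hx
    exact max_eq_left hx.le

theorem hasNormal_oplusInf_right (hK : IsNormBody K) (hL : IsNormBody L) {z w : Fin (k + l) → ℝ}
    (hlt : gauge K (firstPart z) < gauge L (lastPart z)) :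
    HasNormal (oplusInf K L) z w ↔ HasNormal L (lastPart z) (lastPart w) ∧ firstPart w = 0 := by
  have hg : gauge (oplusInf K L) = fun x => max (gauge K (firstPart x)) (gauge L (lastPart x)) :=
    funext (gauge_oplusInf hK hL)
  unfold HasNormal
  rw [hg]
  constructor
  · intro h
    constructor
    · have := h.append_right
      simp only [firstPart_append, lastPart_append] at this
      refine this.congr_of_eventuallyEq ?_
      filter_upwards [hL.continuous_gauge.continuousAt.eventually_const_lt hlt] with x hx
      exact (max_eq_right hx.le).symm
    · have := h.append_left
      simp only [firstPart_append, lastPart_append] at this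
      have h2 : HasFDerivAt (fun _ : Fin k → ℝ => gauge L (lastPart z)) (dotCLM (firstPart w))
          (firstPart z) := by
        refine this.congr_of_eventuallyEq ?_
        filter_upwards [hK.continuous_gauge.continuousAt.eventually_lt_const hlt] with x hx
        exact (max_eq_right hx.le).symm
      have h3 := h2.unique (hasFDerivAt_const _ _)
      apply dotCLM_injective
      rw [h3]
      refine ContinuousLinearMap.ext fun v => ?_
      simp
  · rintro ⟨h1, h2⟩
    rw [dotCLM_eq_parts, h2]
    have h3 := h1.comp z (lastCLM k l).hasFDerivAt
    have h4 : dotCLM (0 : Fin k → ℝ) = 0 := ContinuousLinearMap.ext fun v => by simp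
    rw [h4, ContinuousLinearMap.zero_comp, zero_add]
    refine h3.congr_of_eventuallyEq ?_
    have c1 := (hK.continuous_gauge.comp (continuous_firstPart (l := l))).continuousAt (x := z)
    have c2 := (hL.continuous_gauge.comp (continuous_lastPart (k := k))).continuousAt (x := z)
    filter_upwards [c1.eventually_lt c2 hlt] with x hx
    exact max_eq_right hx.le

/-- The norm `max {g_K, g_L}` is not differentiable where `g_K = g_L`. -/
theorem HasNormal.gauge_ne (hk : 0 < k) (hK : IsNormBody K) (hL : IsNormBody L)
    {z w : Fin (k + l) → ℝ} (h : HasNormal (oplusInf K L) z w) :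
    gauge K (firstPart z) ≠ gauge L (lastPart z) := by
  intro heq
  set c := gauge K (firstPart z) with hc
  have hz := h.ne_zero (by omega) (hK.oplusInf hL)
  have hcpos : 0 < c := by
    rcases parts_ne_zero hz with h | h
    · exact hK.gauge_pos _ h
    · exact heq ▸ hL.gauge_pos _ h
  have h1 := h.hasDerivAt (Fin.append (firstPart z) 0)
  have key : ∀ᶠ t : ℝ in 𝓝 0,
      gauge (oplusInf K L) (z + t • Fin.append (firstPart z) 0) = max ((1 + t) * c) c := by
    filter_upwards [lt_mem_nhds (show (-1 : ℝ) < 0 by norm_num)] with t ht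
    rw [gauge_oplusInf hK hL]
    simp only [firstPart_add, firstPart_smul, firstPart_append, lastPart_add, lastPart_smul,
      lastPart_append, smul_zero, add_zero]
    rw [← heq, hc, ← gauge_smul_nonneg K (by linarith), add_smul, one_smul]
  have h2 := h1.congr_of_eventuallyEq (key.mono fun t ht => ht.symm)
  -- Both `f t = max ((1 + t) c) c` and `f t - t c` are minimal at zero, so a derivative of `f`
  -- there would equal both `0` and `c > 0`.
  have m1 : IsLocalMin (fun t : ℝ => max ((1 + t) * c) c) 0 :=
    Filter.Eventually.of_forall fun t => by simp
  have m2 : IsLocalMin (fun t : ℝ => max ((1 + t) * c) c - t * c) 0 :=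
    Filter.Eventually.of_forall fun t => by
      have := le_max_left ((1 + t) * c) c
      simp only [add_zero, one_mul, max_self, zero_mul, sub_zero]
      linarith
  have e1 := m1.hasDerivAt_eq_zero h2
  have e2 := m2.hasDerivAt_eq_zero (h2.sub ((hasDerivAt_id (0 : ℝ)).mul_const c))
  linarith

end Sums

/-! ### Normals of Hanner polytopes and the reflection law -/

theorem HasNormal.segment {x w : Fin 1 → ℝ} (h : HasNormal (Set.Icc (-1) 1) x w) :
    (w 0 = 1 ∧ 0 < x 0) ∨ (w 0 = -1 ∧ x 0 < 0) := by
  have hx := h.ne_zero one_pos isNormBody_segment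
  have hx0 : x 0 ≠ 0 := fun h0 => hx (by ext i; rw [Subsingleton.elim i 0, h0]; rfl)
  have := h.dotProduct_self
  rw [gauge_segment] at this
  simp only [dotProduct, Finset.univ_unique, Fin.default_eq_zero, Finset.sum_singleton] at this
  rcases lt_or_gt_of_ne hx0 with h0 | h0
  · right
    rw [abs_of_neg h0] at this
    exact ⟨mul_right_cancel₀ hx0 (by linarith), h0⟩
  · left
    rw [abs_of_pos h0] at this
    exact ⟨mul_right_cancel₀ hx0 (by linarith), h0⟩

/-- The normals of a Hanner polytope and of its polar have products `±1`. -/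
theorem IsHanner.dotProduct_normals {n : ℕ} {K : Set (Fin n → ℝ)} (hK : IsHanner n K) :
    ∀ {q w p v : Fin n → ℝ}, HasNormal K q w → HasNormal (_root_.polarBody K) p v →
      dotProduct w v = 1 ∨ dotProduct w v = -1 := by
  -- The claim is symmetric in `K` and `K°`, so `⊕₁` suffices. There a normal of the polar vanishes
  -- in one block, and only the pairing in the other block survives.
  have main : ∀ {k l : ℕ} {K : Set (Fin k → ℝ)} {L : Set (Fin l → ℝ)}, IsHanner k K →
      IsHanner l L →
      (∀ {q w p v : Fin k → ℝ}, HasNormal K q w → HasNormal (_root_.polarBody K) p v →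
        dotProduct w v = 1 ∨ dotProduct w v = -1) →
      (∀ {q w p v : Fin l → ℝ}, HasNormal L q w → HasNormal (_root_.polarBody L) p v →
        dotProduct w v = 1 ∨ dotProduct w v = -1) →
      ∀ {q w p v : Fin (k + l) → ℝ}, HasNormal (oplusOne K L) q w →
        HasNormal (_root_.polarBody (oplusOne K L)) p v →
        dotProduct w v = 1 ∨ dotProduct w v = -1 := by
    intro k l K L hK hL h₁ h₂ q w p v hq hp
    rw [hK.polarBody_oplusOne hL] at hp
    rw [hasNormal_oplusOne hK.isNormBody hL.isNormBody] at hq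
    have hK' := hK.polarBody.isNormBody
    have hL' := hL.polarBody.isNormBody
    rw [dotProduct_parts]
    rcases lt_or_gt_of_ne (hp.gauge_ne hK.pos hK' hL') with hlt | hlt
    · rw [hasNormal_oplusInf_right hK' hL' hlt] at hp
      rw [hp.2, dotProduct_zero, zero_add]
      exact h₂ hq.2 hp.1
    · rw [hasNormal_oplusInf_left hK' hL' hlt] at hp
      rw [hp.2, dotProduct_zero, add_zero]
      exact h₁ hq.1 hp.1
  induction hK with
  | segment =>
    intro q w p v hq hp
    rw [polarBody_segment] at hp
    simp only [dotProduct, Finset.univ_unique, Fin.default_eq_zero, Finset.sum_singleton]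
    rcases hq.segment with h | h <;> rcases hp.segment with h' | h' <;> simp [h.1, h'.1]
  | sumOne hK hL h₁ h₂ => exact main hK hL h₁ h₂
  | @sumInf k l K L hK hL h₁ h₂ =>
    intro q w p v hq hp
    rw [hK.polarBody_oplusInf hL] at hp
    rw [hK.oplusInf_eq hL] at hq
    rw [dotProduct_comm]
    refine main hK.polarBody hL.polarBody ?_ ?_ hp hq
    · intro q w p v hq hp
      rw [hK.polarBody_polarBody] at hp
      rw [dotProduct_comm]; exact h₁ hp hq
    · intro q w p v hq hp
      rw [hL.polarBody_polarBody] at hp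
      rw [dotProduct_comm]; exact h₂ hp hq

/-- A chord which is transversal to the boundary at one end runs in the interior. -/
theorem HasNormal.gauge_chord_lt {n : ℕ} {T : Set (Fin n → ℝ)} (hT : IsNormBody T)
    {p v d : Fin n → ℝ} (hv : HasNormal T p v) (hp : gauge T p = 1) (hd : dotProduct v d ≠ 0)
    {a s : ℝ} (ha : gauge T (p + a • d) ≤ 1) (hs : 0 < s) (hsa : s < a) :
    gauge T (p + s • d) < 1 := by
  by_contra! hge
  have ha0 : 0 < a := hs.trans hsa
  have hconv : ∀ (x y : Fin n → ℝ) (c : ℝ), 0 ≤ c → c ≤ 1 →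
      gauge T (c • x + (1 - c) • y) ≤ c * gauge T x + (1 - c) * gauge T y := by
    intro x y c h0 h1
    have := hT.gauge_add_le (c • x) ((1 - c) • y)
    rwa [gauge_smul_nonneg T h0, gauge_smul_nonneg T (by linarith)] at this
  -- If the chord touches the boundary at `s < a`, convexity forces the norm to be one on all of
  -- `[0, s)`. Then its derivative at `p` along `d` vanishes, against transversality.
  have hone : ∀ t ∈ Set.Ico 0 s, gauge T (p + t • d) = 1 := by
    rintro t ⟨ht0, hts⟩
    apply le_antisymm
    · have h1 := hconv (p + a • d) p (t / a) (by positivity) (by rw [div_le_one ha0]; linarith)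
      have e : (t / a) • (p + a • d) + (1 - t / a) • p = p + t • d := by
        ext i; simp; field_simp; ring
      rw [e, hp] at h1
      have : t / a * gauge T (p + a • d) ≤ t / a * 1 := by gcongr
      linarith
    · have hta : 0 < a - t := by linarith
      -- The weight that writes `p + s d` as a convex combination of `p + t d` and `p + a d`.
      set c := (a - s) / (a - t) with hc
      have hc0 : 0 < c := div_pos (by linarith) hta
      have hc1 : c ≤ 1 := by rw [hc, div_le_one hta]; linarith
      have h1 := hconv (p + t • d) (p + a • d) c hc0.le hc1
      have e : c • (p + t • d) + (1 - c) • (p + a • d) = p + s • d := by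
        ext i; simp [hc]; field_simp; ring
      rw [e] at h1
      have h2 : (1 - c) * gauge T (p + a • d) ≤ (1 - c) * 1 := by
        apply mul_le_mul_of_nonneg_left ha; linarith
      have : c * 1 ≤ c * gauge T (p + t • d) := by linarith
      exact le_of_mul_le_mul_left this hc0
  have h1 : HasDerivWithinAt (fun _ : ℝ => (1 : ℝ)) (dotProduct v d) (Set.Ici 0) 0 := by
    refine ((hv.hasDerivAt d).hasDerivWithinAt).congr_of_eventuallyEq ?_ (by simp [hp])
    filter_upwards [Ico_mem_nhdsGE hs] with t ht
    exact (hone t ht).symm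
  exact hd ((uniqueDiffOn_Ici (0 : ℝ) 0 Set.self_mem_Ici).eq_deriv _ h1
    (hasDerivWithinAt_const _ _ _))

theorem HasNormal.chord_unique {n : ℕ} {T : Set (Fin n → ℝ)} (hT : IsNormBody T)
    {p v d : Fin n → ℝ} (hv : HasNormal T p v) (hp : gauge T p = 1) (hd : dotProduct v d ≠ 0)
    {a b : ℝ} (ha : 0 < a) (hb : 0 < b) (hga : gauge T (p + a • d) = 1)
    (hgb : gauge T (p + b • d) = 1) : a = b := by
  rcases lt_trichotomy a b with h | h | h
  · exact absurd hga (hv.gauge_chord_lt hT hp hd hgb.le ha h).ne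
  · exact h
  · exact absurd hgb (hv.gauge_chord_lt hT hp hd hga.le hb h).ne

theorem ne_zero_of_eq_one_or_neg_one {x : ℝ} (h : x = 1 ∨ x = -1) : x ≠ 0 := by
  rcases h with h | h <;> rw [h] <;> norm_num

/-- In a Hanner polytope the billiard step is determined by the initial data. -/
theorem BilliardStep.unique {n : ℕ} {K : Set (Fin n → ℝ)} (hK : IsHanner n K)
    {q p q₁ p₁ q₂ p₂ : Fin n → ℝ} (h₁ : BilliardStep K (polarBody K) q p q₁ p₁)
    (h₂ : BilliardStep K (polarBody K) q p q₂ p₂) : q₁ = q₂ ∧ p₁ = p₂ := by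
  have hB := hK.isNormBody
  have hT := hK.polarBody.isNormBody
  have nq := hasNormal_outerNormal h₁.smooth_q.2
  have hp : p₁ = p₂ := by
    obtain ⟨a, ha, ea⟩ := h₁.reflect
    obtain ⟨b, hb, eb⟩ := h₂.reflect
    have e1 : p₁ = p + a • -outerNormal K q := by rw [smul_neg, ← ea]; abel
    have e2 : p₂ = p + b • -outerNormal K q := by rw [smul_neg, ← eb]; abel
    have np := hasNormal_outerNormal h₁.smooth_p.2
    have hab := np.chord_unique hT (hT.mem_frontier_iff.1 h₁.smooth_p.1)
      (d := -outerNormal K q)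
      (by rw [dotProduct_neg, neg_ne_zero, dotProduct_comm]
          exact ne_zero_of_eq_one_or_neg_one (hK.dotProduct_normals nq np)) ha hb
      (by rw [← e1]; exact hT.mem_frontier_iff.1 h₁.smooth_p'.1)
      (by rw [← e2]; exact hT.mem_frontier_iff.1 h₂.smooth_p'.1)
    rw [e1, e2, hab]
  subst hp
  refine ⟨?_, rfl⟩
  obtain ⟨a, ha, ea⟩ := h₁.move
  obtain ⟨b, hb, eb⟩ := h₂.move
  rw [sub_eq_iff_eq_add'] at ea eb
  have np := hasNormal_outerNormal h₁.smooth_p'.2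
  have hab := nq.chord_unique hB (hB.mem_frontier_iff.1 h₁.smooth_q.1)
    (ne_zero_of_eq_one_or_neg_one (hK.dotProduct_normals nq np)) ha hb
    (by rw [← ea]; exact hB.mem_frontier_iff.1 h₁.smooth_q'.1)
    (by rw [← eb]; exact hB.mem_frontier_iff.1 h₂.smooth_q'.1)
  rw [ea, eb, hab]

/-! ### Sequences indexed by the integers -/

/-- A nonempty locally finite linear order without endpoints is isomorphic to `ℤ`. This serves to
renumber reflections, both when a trajectory is split and when two are merged. -/
theorem exists_strictMono_range_eq {α : Type*} [LinearOrder α] (S : Set α) (hne : S.Nonempty)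
    (hfin : ∀ a b, (S ∩ Set.Icc a b).Finite) (hmax : ∀ s ∈ S, ∃ s' ∈ S, s < s')
    (hmin : ∀ s ∈ S, ∃ s' ∈ S, s' < s) : ∃ e : ℤ → α, StrictMono e ∧ Set.range e = S := by
  classical
  have hf : ∀ a b : S, (Set.Icc a b).Finite := by
    intro a b
    refine Set.Finite.of_finite_image (f := Subtype.val) ((hfin a b).subset ?_)
      Subtype.val_injective.injOn
    rintro _ ⟨x, hx, rfl⟩
    exact ⟨x.2, hx⟩
  let _ : LocallyFiniteOrder S := LocallyFiniteOrder.ofFiniteIcc hf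
  let _ : SuccOrder S := LinearLocallyFiniteOrder.succOrder S
  let _ : PredOrder S := LinearLocallyFiniteOrder.predOrder S
  have : NoMaxOrder S := ⟨fun a => by
    obtain ⟨b, hb, h⟩ := hmax a a.2
    exact ⟨⟨b, hb⟩, h⟩⟩
  have : NoMinOrder S := ⟨fun a => by
    obtain ⟨b, hb, h⟩ := hmin a a.2
    exact ⟨⟨b, hb⟩, h⟩⟩
  have : Nonempty S := hne.to_subtype
  let e : S ≃o ℤ := orderIsoIntOfLinearSuccPredArch
  refine ⟨fun i => (e.symm i : α), fun i j hij => e.symm.strictMono hij, ?_⟩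
  ext x
  constructor
  · rintro ⟨i, rfl⟩
    exact (e.symm i).2
  · intro hx
    exact ⟨e ⟨x, hx⟩, by simp⟩

/-- The translation by `c` induces an order automorphism of the index set `ℤ`, and these are the
shifts. -/
theorem StrictMono.exists_shift {α : Type*} [AddCommGroup α] [LinearOrder α]
    [IsOrderedAddMonoid α] {e : ℤ → α} (he : StrictMono e) {c : α}
    (h : ∀ x, x ∈ Set.range e ↔ x + c ∈ Set.range e) : ∃ M : ℤ, ∀ i, e (i + M) = e i + c := by
  have h1 : ∀ i, ∃ j, e j = e i + c := fun i => (h _).1 ⟨i, rfl⟩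
  choose φ hφ using h1
  have hstep : ∀ i, φ (i + 1) = φ i + 1 := by
    intro i
    apply le_antisymm
    · by_contra! hlt
      obtain ⟨j, hj⟩ := (h (e (φ i + 1) - c)).2 ⟨φ i + 1, by abel⟩
      have a1 : e i < e j := by
        rw [hj, lt_sub_iff_add_lt, ← hφ]; exact he (by omega)
      have a2 : e j < e (i + 1) := by
        rw [hj, sub_lt_iff_lt_add, ← hφ]; exact he hlt
      have := he.lt_iff_lt.1 a1
      have := he.lt_iff_lt.1 a2
      omega
    · have : e (φ i) < e (φ (i + 1)) := by
        rw [hφ, hφ]; exact add_lt_add_left (he (by omega)) c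
      exact he.lt_iff_lt.1 this
  have hall : ∀ i, φ i = i + φ 0 := by
    intro i
    induction i using Int.induction_on with
    | zero => simp
    | succ i ih => rw [hstep, ih]; ring
    | pred i ih =>
      have := hstep (-(i : ℤ) - 1)
      rw [sub_add_cancel, ih] at this
      omega
  exact ⟨φ 0, fun i => by rw [← hall, hφ]⟩

theorem exists_int_antidifference (a : ℤ → ℝ) : ∃ σ : ℤ → ℝ, ∀ i, σ (i + 1) = σ i + a i := by
  refine ⟨fun i => ∑ k ∈ Finset.range i.toNat, a k -
    ∑ k ∈ Finset.range (-i).toNat, a (-(k : ℤ) - 1), fun i => ?_⟩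
  rcases le_or_gt 0 i with hi | hi
  · obtain ⟨n, rfl⟩ := Int.eq_ofNat_of_zero_le hi
    have e1 : ((n : ℤ) + 1).toNat = n + 1 := by omega
    have e2 : (-((n : ℤ) + 1)).toNat = 0 := by omega
    have e3 : (-(n : ℤ)).toNat = 0 := by omega
    dsimp only
    rw [e1, e2, e3, Int.toNat_natCast, Finset.sum_range_succ]
    simp
  · obtain ⟨n, rfl⟩ : ∃ n : ℕ, i = -((n : ℤ) + 1) := ⟨(-i - 1).toNat, by omega⟩
    have e1 : (-((n : ℤ) + 1) + 1).toNat = 0 := by omega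
    have e2 : (-((n : ℤ) + 1)).toNat = 0 := by omega
    have e3 : (-(-((n : ℤ) + 1) + 1)).toNat = n := by omega
    have e4 : (- -((n : ℤ) + 1)).toNat = n + 1 := by omega
    dsimp only
    rw [e1, e2, e3, e4, Finset.sum_range_succ]
    have e5 : -((n : ℤ) + 1) = -(n : ℤ) - 1 := by ring
    rw [e5]
    simp

theorem add_mul_of_add_eq {m : ℤ} {T : ℝ} {σ : ℤ → ℝ} (h : ∀ i, σ (i + m) = σ i + T) (n i : ℤ) :
    σ (i + n * m) = σ i + n * T := by
  induction n using Int.induction_on with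
  | zero => simp
  | succ n ih =>
    have : i + ((n : ℤ) + 1) * m = i + n * m + m := by ring
    rw [this, h, ih]; push_cast; ring
  | pred n ih =>
    have := h (i + (-(n : ℤ) - 1) * m)
    have e : i + (-(n : ℤ) - 1) * m + m = i + -(n : ℤ) * m := by ring
    rw [e, ih] at this
    push_cast at this ⊢
    linarith

theorem exists_le_of_add_eq {m : ℤ} {T : ℝ} (hT : 0 < T) {σ : ℤ → ℝ}
    (h : ∀ i, σ (i + m) = σ i + T) (x : ℝ) : ∃ j, σ j ≤ x := by
  obtain ⟨n, hn⟩ := exists_nat_gt ((σ 0 - x) / T)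
  refine ⟨0 + (-(n : ℤ)) * m, ?_⟩
  rw [add_mul_of_add_eq h]
  rw [div_lt_iff₀ hT] at hn
  push_cast
  linarith

theorem exists_lt_of_add_eq {m : ℤ} {T : ℝ} (hT : 0 < T) {σ : ℤ → ℝ}
    (h : ∀ i, σ (i + m) = σ i + T) (x : ℝ) : ∃ j, x < σ j := by
  obtain ⟨n, hn⟩ := exists_nat_gt ((x - σ 0) / T)
  refine ⟨0 + (n : ℤ) * m, ?_⟩
  rw [add_mul_of_add_eq h]
  rw [div_lt_iff₀ hT] at hn
  push_cast
  linarith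

theorem StrictMono.exists_floor {m : ℤ} {T : ℝ} (hT : 0 < T) {σ : ℤ → ℝ} (hσ : StrictMono σ)
    (h : ∀ i, σ (i + m) = σ i + T) (x : ℝ) : ∃ u, σ u ≤ x ∧ x < σ (u + 1) := by
  obtain ⟨b, hb⟩ := exists_lt_of_add_eq hT h x
  obtain ⟨u, hu, hmax⟩ := Int.exists_greatest_of_bdd (P := fun j => σ j ≤ x)
    ⟨b, fun z hz => (hσ.lt_iff_lt.1 (hz.trans_lt hb)).le⟩ (exists_le_of_add_eq hT h x)
  refine ⟨u, hu, ?_⟩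
  by_contra! hle
  have := hmax _ hle
  omega

theorem StrictMono.floor_unique {σ : ℤ → ℝ} (hσ : StrictMono σ) {x : ℝ} {u w : ℤ}
    (hu : σ u ≤ x) (hu' : x < σ (u + 1)) (hw : σ w ≤ x) (hw' : x < σ (w + 1)) : u = w := by
  have := hσ.lt_iff_lt.1 (hu.trans_lt hw')
  have := hσ.lt_iff_lt.1 (hw.trans_lt hu')
  omega

theorem StrictMono.finite_preimage_Icc {m : ℤ} {T : ℝ} (hT : 0 < T) {σ : ℤ → ℝ}
    (hσ : StrictMono σ) (h : ∀ i, σ (i + m) = σ i + T) (a b : ℝ) :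
    (σ ⁻¹' Set.Icc a b).Finite := by
  obtain ⟨i, hi⟩ := exists_le_of_add_eq hT h a
  obtain ⟨j, hj⟩ := exists_lt_of_add_eq hT h b
  refine (Set.finite_Icc i j).subset ?_
  rintro x ⟨h1, h2⟩
  exact ⟨hσ.le_iff_le.1 (hi.trans h1), hσ.le_iff_le.1 (h2.trans hj.le)⟩

theorem int_eq_of_succ_eq {α : Type*} {f : ℤ → α} (h : ∀ i, f (i + 1) = f i) (i j : ℤ) :
    f i = f j := by
  have : ∀ i, f i = f 0 := by
    intro i
    induction i using Int.induction_on with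
    | zero => rfl
    | succ i ih => rw [h, ih]
    | pred i ih => rw [← ih, ← h, sub_add_cancel]
  rw [this i, this j]

/-! ### Closed trajectories of Hanner polytopes have action four -/

/-- A closed billiard trajectory in `K × T` with `m` bounces, where the momentum moves with
velocity `-outerNormal K (q i)` and reaches `p i` at time `σ i`. -/
structure IsTimedTrajectory {n : ℕ} (K T : Set (Fin n → ℝ)) (m : ℤ) (q p : ℤ → Fin n → ℝ)
    (σ : ℤ → ℝ) : Prop where
  pos : 0 < m
  periodic_q : ∀ i, q (i + m) = q i
  periodic_p : ∀ i, p (i + m) = p i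
  gauge_q : ∀ i, gauge K (q i) = 1
  gauge_p : ∀ i, gauge T (p i) = 1
  diff_q : ∀ i, DifferentiableAt ℝ (gauge K) (q i)
  diff_p : ∀ i, DifferentiableAt ℝ (gauge T) (p i)
  lt_succ : ∀ i, σ i < σ (i + 1)
  reflect : ∀ i, p (i + 1) = p i - (σ (i + 1) - σ i) • outerNormal K (q i)
  move : ∀ i, ∃ b : ℝ, 0 < b ∧ q (i + 1) = q i + b • outerNormal T (p (i + 1))

/-- After time two all closed trajectories in `K × K°` arrive at the antipodal state. -/
def IsAntipodal {n : ℕ} (K : Set (Fin n → ℝ)) : Prop :=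
  ∀ (m : ℤ) (q p : ℤ → Fin n → ℝ) (σ : ℤ → ℝ), IsTimedTrajectory K (polarBody K) m q p σ →
    ∃ M : ℤ, 0 < M ∧ ∀ i, q (i + M) = -q i ∧ p (i + M) = -p i ∧ σ (i + M) = σ i + 2

theorem outerNormal_neg {n : ℕ} {K : Set (Fin n → ℝ)} (hK : IsNormBody K) {x : Fin n → ℝ}
    (h : DifferentiableAt ℝ (gauge K) x) : outerNormal K (-x) = -outerNormal K x :=
  ((hasNormal_outerNormal h).neg hK).outerNormal_eq

theorem outerNormal_smul {n : ℕ} {K : Set (Fin n → ℝ)} {x : Fin n → ℝ} {c : ℝ} (hc : 0 < c)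
    (h : DifferentiableAt ℝ (gauge K) x) : outerNormal K (c • x) = outerNormal K x :=
  ((hasNormal_outerNormal h).smul hc).outerNormal_eq

namespace IsTimedTrajectory

variable {n : ℕ} {K T : Set (Fin n → ℝ)} {m : ℤ} {q p : ℤ → Fin n → ℝ} {σ : ℤ → ℝ}

theorem strictMono (h : IsTimedTrajectory K T m q p σ) : StrictMono σ :=
  strictMono_int_of_lt_succ h.lt_succ

theorem outerNormal_ne_zero (h : IsTimedTrajectory K T m q p σ) (i : ℤ) :
    outerNormal K (q i) ≠ 0 :=
  (hasNormal_outerNormal (h.diff_q i)).ne_zero' (by rw [h.gauge_q]; exact one_pos)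

/-- Coordinates and momenta can be interchanged. -/
theorem dual (hK : IsNormBody K) (h : IsTimedTrajectory K T m q p σ) :
    IsTimedTrajectory T K m (fun i => p (i + 1)) (fun i => -q i)
      (fun i => σ i + dotProduct (p i) (q i)) := by
  -- Adding `⟨p, q⟩` to the clock makes it measure the motion of the coordinate: by Euler's identity
  -- one step changes `⟨p, q⟩` by `b` minus the elapsed momentum time.
  have key : ∀ i, ∃ b : ℝ, 0 < b ∧ q (i + 1) = q i + b • outerNormal T (p (i + 1)) ∧
      σ (i + 1) + dotProduct (p (i + 1)) (q (i + 1)) = σ i + dotProduct (p i) (q i) + b := by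
    intro i
    obtain ⟨b, hb, e⟩ := h.move i
    refine ⟨b, hb, e, ?_⟩
    have h1 := (hasNormal_outerNormal (h.diff_p (i + 1))).dotProduct_self
    have h2 := (hasNormal_outerNormal (h.diff_q i)).dotProduct_self
    rw [h.gauge_p, dotProduct_comm] at h1
    rw [h.gauge_q] at h2
    rw [e, dotProduct_add, dotProduct_smul, h1, h.reflect i, sub_dotProduct, smul_dotProduct, h2]
    simp only [smul_eq_mul]
    ring
  constructor
  · exact h.pos
  · intro i
    have : i + m + 1 = i + 1 + m := by ring
    simp only [this, h.periodic_p]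
  · intro i; simp only [h.periodic_q]
  · intro i; exact h.gauge_p _
  · intro i; rw [hK.gauge_neg]; exact h.gauge_q _
  · intro i; exact h.diff_p _
  · intro i; exact ((hasNormal_outerNormal (h.diff_q i)).neg hK).differentiableAt
  · intro i
    obtain ⟨b, hb, -, e⟩ := key i
    linarith
  · intro i
    obtain ⟨b, hb, e, e'⟩ := key i
    rw [e', e, add_sub_cancel_left]
    abel
  · intro i
    refine ⟨_, sub_pos.2 (h.lt_succ (i + 1)), ?_⟩
    rw [outerNormal_neg hK (h.diff_q _), h.reflect (i + 1), smul_neg, sub_eq_add_neg]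

end IsTimedTrajectory

theorem isAntipodal_segment : IsAntipodal (Set.Icc (-1 : Fin 1 → ℝ) 1) := by
  intro m q p σ h
  rw [polarBody_segment] at h
  refine ⟨1, one_pos, ?_⟩
  have hval : ∀ x : Fin 1 → ℝ, gauge (Set.Icc (-1) 1) x = 1 →
      DifferentiableAt ℝ (gauge (Set.Icc (-1 : Fin 1 → ℝ) 1)) x →
      outerNormal (Set.Icc (-1) 1) x 0 = x 0 ∧ (x 0 = 1 ∨ x 0 = -1) := by
    intro x hx hd
    rw [gauge_segment] at hx
    rcases (hasNormal_outerNormal hd).segment with h | h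
    · rw [abs_of_pos h.2] at hx
      exact ⟨by rw [h.1, hx], .inl hx⟩
    · rw [abs_of_neg h.2] at hx
      exact ⟨by rw [h.1]; linarith, .inr (by linarith)⟩
  have hq := fun i => hval _ (h.gauge_q i) (h.diff_q i)
  have hp := fun i => hval _ (h.gauge_p i) (h.diff_p i)
  intro i
  have h1 := congrFun (h.reflect i) 0
  obtain ⟨b, hb, h2⟩ := h.move i
  replace h2 := congrFun h2 0
  have hlt := h.lt_succ i
  simp only [Pi.sub_apply, Pi.smul_apply, Pi.add_apply, smul_eq_mul, (hq _).1, (hp _).1] at h1 h2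
  have ext1 : ∀ x y : Fin 1 → ℝ, x 0 = -y 0 → x = -y := by
    intro x y hxy
    ext j
    rw [Subsingleton.elim j 0]
    exact hxy
  -- All states are `±1`. The direction of motion rules out every sign pattern except those where
  -- both entries flip, and crossing `[-1, 1]` takes time two.
  rcases (hq i).2 with a | a <;> rcases (hq (i + 1)).2 with b | b <;>
    rcases (hp i).2 with c | c <;> rcases (hp (i + 1)).2 with d | d <;>
    simp only [a, b, c, d] at h1 h2 <;>
    first
    | (exfalso; linarith)
    | exact ⟨ext1 _ _ (by linarith), ext1 _ _ (by linarith), by linarith⟩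

/-- The two clocks differ by `⟨p, q⟩`, which does not change when both vectors are negated; so the
time two is the same on both. -/
theorem IsAntipodal.dual {n : ℕ} {K : Set (Fin n → ℝ)} (hK : IsNormBody K)
    (hKK : polarBody (polarBody K) = K) (h : IsAntipodal (polarBody K)) : IsAntipodal K := by
  intro m q p σ ht
  have hd := ht.dual hK
  conv at hd => arg 2; rw [← hKK]
  obtain ⟨M, hM, hs⟩ := h m _ _ _ hd
  refine ⟨M, hM, fun i => ?_⟩
  have h1 : q (i + M) = -q i := by simpa [neg_eq_iff_eq_neg] using (hs i).2.1
  have h2 : p (i + M) = -p i := by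
    have := (hs (i - 1)).1
    simpa [show i - 1 + M + 1 = i + M by ring] using this
  refine ⟨h1, h2, ?_⟩
  have h3 := (hs i).2.2
  rw [h1, h2, dotProduct_neg, neg_dotProduct, neg_neg] at h3
  linarith

/-- A component `x`, `y` of a closed trajectory, where `x` moves at the times `i ∈ Z` only. -/
structure IsComponent {n : ℕ} (K T : Set (Fin n → ℝ)) (m : ℤ) (Z : Set ℤ) (α : ℝ)
    (x y : ℤ → Fin n → ℝ) (σ : ℤ → ℝ) : Prop where
  pos : 0 < m
  periodic_x : ∀ i, x (i + m) = x i
  periodic_y : ∀ i, y (i + m) = y i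
  periodic_Z : ∀ i, i + m ∈ Z ↔ i ∈ Z
  scale_pos : 0 < α
  gauge_x : ∀ i, gauge K (x i) = α
  diff_x : ∀ i, DifferentiableAt ℝ (gauge K) (x i)
  gauge_y : ∀ i ∈ Z, gauge T (y i) = 1
  diff_y : ∀ i ∈ Z, DifferentiableAt ℝ (gauge T) (y i)
  lt_succ : ∀ i, σ i < σ (i + 1)
  reflect : ∀ i, y (i + 1) = y i - (σ (i + 1) - σ i) • outerNormal K (x i)
  stay : ∀ i, i + 1 ∉ Z → x (i + 1) = x i
  move : ∀ i, i + 1 ∈ Z → ∃ b : ℝ, 0 < b ∧ x (i + 1) = x i + b • outerNormal T (y (i + 1))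

namespace IsComponent

variable {n : ℕ} {K T : Set (Fin n → ℝ)} {m : ℤ} {Z : Set ℤ} {α : ℝ} {x y : ℤ → Fin n → ℝ}
  {σ : ℤ → ℝ}

theorem strictMono (h : IsComponent K T m Z α x y σ) : StrictMono σ :=
  strictMono_int_of_lt_succ h.lt_succ

/-- Otherwise `x` would be constant and `y` would drift forever in one nonzero direction, contrary
to periodicity. -/
theorem nonempty (h : IsComponent K T m Z α x y σ) : Z.Nonempty := by
  by_contra hZ
  rw [Set.not_nonempty_iff_eq_empty] at hZ
  have hx : ∀ i j, x i = x j := int_eq_of_succ_eq fun i => h.stay i (by simp [hZ])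
  have hy := int_eq_of_succ_eq (f := fun i => y i + σ i • outerNormal K (x 0)) (fun i => by
    rw [h.reflect i, hx i 0, sub_smul]
    abel) (0 + m) 0
  simp only [h.periodic_y, add_right_inj] at hy
  have := smul_left_injective ℝ ((hasNormal_outerNormal (h.diff_x 0)).ne_zero'
    (by rw [h.gauge_x]; exact h.scale_pos)) hy
  have := h.strictMono.injective this
  have := h.pos
  omega

theorem exists_le_mem (h : IsComponent K T m Z α x y σ) (i : ℤ) : ∃ j ∈ Z, j ≤ i := by
  obtain ⟨z, hz⟩ := h.nonempty
  have : ∀ n : ℕ, z - n * m ∈ Z := by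
    intro n
    induction n with
    | zero => simpa using hz
    | succ n ih =>
      rw [← h.periodic_Z]
      convert ih using 1
      push_cast; ring
  refine ⟨_, this (z - i).toNat, ?_⟩
  have := h.pos
  have : ((z - i).toNat : ℤ) ≤ (z - i).toNat * m := by nlinarith
  have := Int.self_le_toNat (z - i)
  omega

theorem exists_enumeration (h : IsComponent K T m Z α x y σ) :
    ∃ e : ℤ → ℤ, StrictMono e ∧ Set.range e = Z := by
  have hm := h.pos
  refine exists_strictMono_range_eq Z h.nonempty (fun a b => (Set.finite_Icc a b).subset
    Set.inter_subset_right) (fun s hs => ⟨s + m, (h.periodic_Z s).2 hs, by omega⟩)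
    (fun s hs => ⟨s - m, ?_, by omega⟩)
  rw [← h.periodic_Z, sub_add_cancel]
  exact hs

/-- At the indices outside `Z` only the other component is reflected, so this one continues straight
on. Dropping these indices and rescaling `x` to norm one leaves a genuine trajectory with the same
clock. -/
theorem isTimedTrajectory (h : IsComponent K T m Z α x y σ) {e : ℤ → ℤ}
    (he : StrictMono e) (hr : Set.range e = Z) : ∃ m' : ℤ,
      IsTimedTrajectory K T m' (fun j => α⁻¹ • x (e j)) (fun j => y (e j)) (fun j => σ (e j)) := by
  have hmem : ∀ j, e j ∈ Z := fun j => hr ▸ ⟨j, rfl⟩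
  have hα := h.scale_pos
  obtain ⟨m', hm'⟩ := he.exists_shift (c := m) (fun i => by rw [hr]; exact (h.periodic_Z i).symm)
  have between : ∀ j i, e j ≤ i → i < e (j + 1) →
      x i = x (e j) ∧ y i = y (e j) - (σ i - σ (e j)) • outerNormal K (x (e j)) := by
    intro j i hji
    induction i, hji using Int.leInduction with
    | base => intro _; simp
    | succ i hji ih =>
      intro hi
      obtain ⟨h1, h2⟩ := ih (by omega)
      have hZ : i + 1 ∉ Z := by
        rw [← hr]
        rintro ⟨j', hj'⟩
        rw [← hj'] at hi
        have h3 := he.lt_iff_lt.1 hi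
        have h4 : e j < e j' := by omega
        have h5 := he.lt_iff_lt.1 h4
        omega
      refine ⟨(h.stay i hZ).trans h1, ?_⟩
      rw [h.reflect i, h2, h1, sub_sub, ← add_smul]
      congr 2; ring
  have last : ∀ j, x (e (j + 1) - 1) = x (e j) ∧
      y (e (j + 1) - 1) = y (e j) - (σ (e (j + 1) - 1) - σ (e j)) • outerNormal K (x (e j)) := by
    intro j
    have := he (show j < j + 1 by omega)
    exact between j _ (by omega) (by omega)
  have hN : ∀ j, outerNormal K (α⁻¹ • x (e j)) = outerNormal K (x (e j)) :=
    fun j => outerNormal_smul (by positivity) (h.diff_x _)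
  refine ⟨m', ?_, ?_, ?_, ?_, fun j => h.gauge_y _ (hmem j), ?_, fun j => h.diff_y _ (hmem j), ?_,
    ?_, ?_⟩
  · have h1 := hm' 0
    have h2 := h.pos
    have : e 0 < e (0 + m') := by omega
    have := he.lt_iff_lt.1 this
    omega
  · intro j; simp only [hm', h.periodic_x]
  · intro j; simp only [hm', h.periodic_y]
  · intro j
    rw [gauge_smul_nonneg K (by positivity), h.gauge_x, inv_mul_cancel₀ hα.ne']
  · intro j
    exact ((hasNormal_outerNormal (h.diff_x _)).smul (by positivity)).differentiableAt
  · intro j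
    exact h.strictMono (he (by omega))
  · intro j
    have h1 := h.reflect (e (j + 1) - 1)
    rw [sub_add_cancel, (last j).1, (last j).2, sub_sub, ← add_smul] at h1
    rw [hN, h1]
    congr 2; ring
  · intro j
    obtain ⟨b, hb, h1⟩ := h.move (e (j + 1) - 1) (by rw [sub_add_cancel]; exact hmem _)
    rw [sub_add_cancel, (last j).1] at h1
    refine ⟨α⁻¹ * b, by positivity, ?_⟩
    rw [h1, smul_add, mul_smul]

theorem exists_antipode (hA : IsAntipodal K)
    (h : IsComponent K (polarBody K) m Z α x y σ) :
    (∀ i ∈ Z, ∃ i' ∈ Z, σ i' = σ i + 2 ∧ x i' = -x i ∧ y i' = -y i) ∧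
      ∀ i ∈ Z, ∃ i' ∈ Z, σ i = σ i' + 2 := by
  obtain ⟨e, he, hr⟩ := h.exists_enumeration
  obtain ⟨m', ht⟩ := h.isTimedTrajectory he hr
  obtain ⟨M, -, hs⟩ := hA _ _ _ _ ht
  have hmem : ∀ j, e j ∈ Z := fun j => hr ▸ ⟨j, rfl⟩
  constructor
  · intro i hi
    rw [← hr] at hi
    obtain ⟨j, rfl⟩ := hi
    obtain ⟨h1, h2, h3⟩ := hs j
    refine ⟨_, hmem (j + M), h3, ?_, h2⟩
    rw [← smul_neg] at h1
    exact smul_right_injective _ (inv_ne_zero h.scale_pos.ne') h1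
  · intro i hi
    rw [← hr] at hi
    obtain ⟨j, rfl⟩ := hi
    refine ⟨_, hmem (j - M), ?_⟩
    have := (hs (j - M)).2.2
    rwa [sub_add_cancel] at this

/-- Between consecutive members of `Z` the component moves with constant velocity, so antipodality
propagates forward from the last member of `Z`. -/
theorem antipode_of_mem (hK : IsNormBody K) (h : IsComponent K T m Z α x y σ) {M : ℤ}
    (hσ : ∀ i, σ (i + M) = σ i + 2) (hZ : ∀ i, i ∉ Z → i + M ∉ Z)
    (hxy : ∀ i ∈ Z, x (i + M) = -x i ∧ y (i + M) = -y i) (i : ℤ) :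
    x (i + M) = -x i ∧ y (i + M) = -y i := by
  obtain ⟨j, hj, hji⟩ := h.exists_le_mem i
  induction i, hji using Int.leInduction with
  | base => exact hxy j hj
  | succ i hji ih =>
    by_cases hi : i + 1 ∈ Z
    · exact hxy _ hi
    have hi' := hZ _ hi
    have e : i + 1 + M = i + M + 1 := by ring
    have hσ' := hσ (i + 1)
    rw [e] at hi' hσ' ⊢
    rw [h.stay _ hi', h.stay _ hi, h.reflect (i + M), h.reflect i, ih.1, ih.2,
      outerNormal_neg hK (h.diff_x i), hσ', hσ i]
    refine ⟨rfl, ?_⟩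
    rw [smul_neg, add_sub_add_right_eq_sub]
    abel

end IsComponent

theorem IsAntipodal.oplusOne {k l : ℕ} {K : Set (Fin k → ℝ)} {L : Set (Fin l → ℝ)}
    (hK : IsHanner k K) (hL : IsHanner l L) (hAK : IsAntipodal K) (hAL : IsAntipodal L) :
    IsAntipodal (oplusOne K L) := by
  intro m q p σ h
  rw [hK.polarBody_oplusOne hL] at h
  have bK := hK.isNormBody
  have bL := hL.isNormBody
  have bK' := hK.polarBody.isNormBody
  have bL' := hL.polarBody.isNormBody
  set Z : Set ℤ := {i | gauge (polarBody L) (lastPart (p i)) <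
    gauge (polarBody K) (firstPart (p i))} with hZ
  have hnq := fun i => (hasNormal_oplusOne bK bL).1 (hasNormal_outerNormal (h.diff_q i))
  have memZ : ∀ i ∈ Z, HasNormal (polarBody K) (firstPart (p i))
      (firstPart (outerNormal (oplusInf (polarBody K) (polarBody L)) (p i))) ∧
      lastPart (outerNormal (oplusInf (polarBody K) (polarBody L)) (p i)) = 0 ∧
      gauge (polarBody K) (firstPart (p i)) = 1 := by
    intro i hi
    have h1 := (hasNormal_oplusInf_left bK' bL' hi).1 (hasNormal_outerNormal (h.diff_p i))
    have h2 := h.gauge_p i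
    rw [gauge_oplusInf bK' bL', max_eq_left hi.le] at h2
    exact ⟨h1.1, h1.2, h2⟩
  have memZc : ∀ i ∉ Z, HasNormal (polarBody L) (lastPart (p i))
      (lastPart (outerNormal (oplusInf (polarBody K) (polarBody L)) (p i))) ∧
      firstPart (outerNormal (oplusInf (polarBody K) (polarBody L)) (p i)) = 0 ∧
      gauge (polarBody L) (lastPart (p i)) = 1 := by
    intro i hi
    have h0 : gauge (polarBody K) (firstPart (p i)) < gauge (polarBody L) (lastPart (p i)) :=
      lt_of_le_of_ne (not_lt.1 hi) ((hasNormal_outerNormal (h.diff_p i)).gauge_ne hK.pos bK' bL')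
    have h1 := (hasNormal_oplusInf_right bK' bL' h0).1 (hasNormal_outerNormal (h.diff_p i))
    have h2 := h.gauge_p i
    rw [gauge_oplusInf bK' bL', max_eq_right h0.le] at h2
    exact ⟨h1.1, h1.2, h2⟩
  have stayK : ∀ i, i + 1 ∉ Z → firstPart (q (i + 1)) = firstPart (q i) := by
    intro i hi
    obtain ⟨b, -, e⟩ := h.move i
    rw [e, firstPart_add, firstPart_smul, (memZc _ hi).2.1, smul_zero, add_zero]
  have stayL : ∀ i, i + 1 ∈ Z → lastPart (q (i + 1)) = lastPart (q i) := by
    intro i hi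
    obtain ⟨b, -, e⟩ := h.move i
    rw [e, lastPart_add, lastPart_smul, (memZ _ hi).2.1, smul_zero, add_zero]
  have hsum : ∀ i, gauge K (firstPart (q i)) + gauge L (lastPart (q i)) = 1 := by
    intro i; rw [← gauge_oplusOne bK bL, h.gauge_q]
  -- Each step fixes one of the two blocks, and the norms of the blocks add up to one; hence neither
  -- norm ever changes.
  have gK : ∀ i j, gauge K (firstPart (q i)) = gauge K (firstPart (q j)) := by
    refine int_eq_of_succ_eq (f := fun i => gauge K (firstPart (q i))) fun i => ?_
    by_cases hi : i + 1 ∈ Z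
    · have h1 := hsum i
      have h2 := hsum (i + 1)
      rw [stayL i hi] at h2
      linarith
    · simp only [stayK i hi]
  have gL : ∀ i j, gauge L (lastPart (q i)) = gauge L (lastPart (q j)) := by
    intro i j
    linarith [hsum i, hsum j, gK i j]
  have perZ : ∀ i, i + m ∈ Z ↔ i ∈ Z := by
    intro i; simp only [hZ, Set.mem_ofPred_eq, h.periodic_p]
  have cK : IsComponent K (polarBody K) m Z (gauge K (firstPart (q 0)))
      (fun i => firstPart (q i)) (fun i => firstPart (p i)) σ := by
    refine ⟨h.pos, fun i => by rw [h.periodic_q], fun i => by rw [h.periodic_p], perZ,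
      bK.gauge_pos _ ((hnq 0).1.ne_zero hK.pos bK), fun i => gK i 0,
      fun i => (hnq i).1.differentiableAt, fun i hi => (memZ i hi).2.2,
      fun i hi => (memZ i hi).1.differentiableAt, h.lt_succ, ?_, stayK, ?_⟩
    · intro i
      rw [(hnq i).1.outerNormal_eq, h.reflect i, firstPart_sub, firstPart_smul]
    · intro i hi
      obtain ⟨b, hb, e⟩ := h.move i
      refine ⟨b, hb, ?_⟩
      rw [(memZ _ hi).1.outerNormal_eq, e, firstPart_add, firstPart_smul]
  have cL : IsComponent L (polarBody L) m Zᶜ (gauge L (lastPart (q 0)))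
      (fun i => lastPart (q i)) (fun i => lastPart (p i)) σ := by
    refine ⟨h.pos, fun i => by rw [h.periodic_q], fun i => by rw [h.periodic_p],
      fun i => not_congr (perZ i),
      bL.gauge_pos _ ((hnq 0).2.ne_zero hL.pos bL), fun i => gL i 0,
      fun i => (hnq i).2.differentiableAt, fun i hi => (memZc i hi).2.2,
      fun i hi => (memZc i hi).1.differentiableAt, h.lt_succ, ?_,
      fun i hi => stayL i (not_not.1 hi), ?_⟩
    · intro i
      rw [(hnq i).2.outerNormal_eq, h.reflect i, lastPart_sub, lastPart_smul]
    · intro i hi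
      obtain ⟨b, hb, e⟩ := h.move i
      refine ⟨b, hb, ?_⟩
      rw [(memZc _ hi).1.outerNormal_eq, e, lastPart_add, lastPart_smul]
  obtain ⟨fK, rK⟩ := cK.exists_antipode hAK
  obtain ⟨fL, rL⟩ := cL.exists_antipode hAL
  -- The reflection times of each component are invariant under translation by two, hence so is
  -- their union. This yields one index shift `M` for both components.
  obtain ⟨M, hM⟩ := h.strictMono.exists_shift (c := (2 : ℝ)) (by
    intro s
    constructor
    · rintro ⟨i, rfl⟩
      by_cases hi : i ∈ Z
      · obtain ⟨i', -, e, -⟩ := fK i hi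
        exact ⟨i', e⟩
      · obtain ⟨i', -, e, -⟩ := fL i hi
        exact ⟨i', e⟩
    · rintro ⟨i, hs⟩
      by_cases hi : i ∈ Z
      · obtain ⟨i', -, e⟩ := rK i hi
        exact ⟨i', by linarith⟩
      · obtain ⟨i', -, e⟩ := rL i hi
        exact ⟨i', by linarith⟩)
  have aK : ∀ i ∈ Z, i + M ∈ Z ∧ firstPart (q (i + M)) = -firstPart (q i) ∧
      firstPart (p (i + M)) = -firstPart (p i) := by
    intro i hi
    obtain ⟨i', hi', e, h1, h2⟩ := fK i hi
    rw [← hM] at e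
    rw [← h.strictMono.injective e]
    exact ⟨hi', h1, h2⟩
  have aL : ∀ i ∉ Z, i + M ∉ Z ∧ lastPart (q (i + M)) = -lastPart (q i) ∧
      lastPart (p (i + M)) = -lastPart (p i) := by
    intro i hi
    obtain ⟨i', hi', e, h1, h2⟩ := fL i hi
    rw [← hM] at e
    rw [← h.strictMono.injective e]
    exact ⟨hi', h1, h2⟩
  refine ⟨M, ?_, fun i => ?_⟩
  · have h1 := hM 0
    have h2 : σ 0 < σ (0 + M) := by linarith
    have := h.strictMono.lt_iff_lt.1 h2
    omega
  · have h1 := cK.antipode_of_mem bK hM (fun i hi => (aL i hi).1) (fun i hi => (aK i hi).2) i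
    have h2 := cL.antipode_of_mem bL hM (fun i hi => not_not.2 (aK i (not_not.1 hi)).1)
      (fun i hi => (aL i hi).2) i
    exact ⟨parts_ext h1.1 h2.1, parts_ext h1.2 h2.2, hM i⟩

theorem IsHanner.isAntipodal {n : ℕ} {K : Set (Fin n → ℝ)} (hK : IsHanner n K) :
    IsAntipodal K ∧ IsAntipodal (_root_.polarBody K) := by
  induction hK with
  | segment => rw [polarBody_segment]; exact ⟨isAntipodal_segment, isAntipodal_segment⟩
  | sumOne hK hL h₁ h₂ =>
    have h := IsAntipodal.oplusOne hK hL h₁.1 h₂.1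
    have hs := hK.sumOne hL
    refine ⟨h, IsAntipodal.dual hs.polarBody.isNormBody ?_ ?_⟩
    · rw [hs.polarBody_polarBody]
    · rwa [hs.polarBody_polarBody]
  | sumInf hK hL h₁ h₂ =>
    have h := IsAntipodal.oplusOne hK.polarBody hL.polarBody h₁.2 h₂.2
    have hs := hK.sumInf hL
    rw [← hK.polarBody_oplusInf hL] at h
    exact ⟨IsAntipodal.dual hs.isNormBody hs.polarBody_polarBody h, h⟩

/-- A closed trajectory whose bounce points have no smaller period takes time four. -/
theorem IsTimedTrajectory.action_eq_four {n : ℕ} {K : Set (Fin n → ℝ)} (hK : IsHanner n K) {m : ℕ}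
    {q p : ℤ → Fin n → ℝ} {σ : ℤ → ℝ} (h : IsTimedTrajectory K (polarBody K) m q p σ)
    (hs : ∀ d : ℕ, 0 < d → d < m → ¬ ∀ i, q (i + d) = q i) (i : ℤ) :
    σ (i + m) = σ i + 4 := by
  have hm := h.pos
  obtain ⟨M, hM, hA⟩ := hK.isAntipodal.1 _ _ _ _ h
  have hper : ∀ c i : ℤ, q (i + c * m) = q i := by
    intro c
    induction c using Int.induction_on with
    | zero => simp
    | succ c ih =>
      intro i
      rw [show i + ((c : ℤ) + 1) * m = i + c * m + m by ring, h.periodic_q, ih]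
    | pred c ih =>
      intro i
      rw [← h.periodic_q, show i + (-(c : ℤ) - 1) * m + m = i + -(c : ℤ) * m by ring, ih]
  have hdvd : ∀ d : ℤ, (∀ i, q (i + d) = q i) → (m : ℤ) ∣ d := by
    intro d hd
    have h0 := Int.emod_nonneg d hm.ne'
    have h1 := Int.emod_lt_of_pos d hm
    have he := Int.emod_add_mul_ediv d m
    by_contra hnd
    have hne : d % m ≠ 0 := fun h0 => hnd (Int.dvd_of_emod_eq_zero h0)
    refine hs (d % m).toNat (by omega) (by omega) fun i => ?_
    rw [Int.toNat_of_nonneg h0, ← hd i, ← hper (d / m), add_assoc, mul_comm (d / _), he]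
  obtain ⟨c, hc⟩ : (m : ℤ) ∣ 2 * M := hdvd _ fun i => by
    rw [show i + 2 * M = i + M + M by ring, (hA _).1, (hA _).1, neg_neg]
  -- For even `c` the shift by `M` would be a whole number of periods, so that `q 0 = -q 0`.
  have hodd : ¬ Even c := by
    rintro ⟨c', rfl⟩
    have hM' : M = c' * m := by linarith
    have h1 := (hA 0).1
    rw [hM', hper] at h1
    have h2 : q 0 = 0 := self_eq_neg.1 h1
    have h3 := h.gauge_q 0
    rw [h2, gauge_zero] at h3
    exact zero_ne_one h3
  rw [Int.not_even_iff_odd] at hodd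
  obtain ⟨e, he⟩ := hodd
  have hS : ∃ S, ∀ i, σ (i + m) = σ i + S := by
    refine ⟨σ (0 + m) - σ 0, fun i => ?_⟩
    have := int_eq_of_succ_eq (f := fun i => σ (i + m) - σ i) (fun i => ?_) i 0
    · linarith
    · have h1 := h.reflect (i + m)
      have h2 := h.reflect i
      rw [show i + m + 1 = i + 1 + m by ring, h.periodic_p, h.periodic_p, h.periodic_q, h2,
        sub_right_inj] at h1
      have h3 := smul_left_injective ℝ (h.outerNormal_ne_zero i) h1
      linarith
  obtain ⟨S, hS⟩ := hS
  have hT := hK.polarBody.isNormBody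
  have hmul := add_mul_of_add_eq hS
  have hmulM := add_mul_of_add_eq fun i => (hA i).2.2
  have hcS : (c : ℝ) * S = 4 := by
    have h1 := hmul c 0
    have h2 := hmulM 2 0
    rw [hc, mul_comm (m : ℤ) c] at h2
    push_cast at h2
    linarith
  -- The velocity of the momentum is minus a normal of `K`; normals lie in `K°`, so the speed is at
  -- most one.
  have hlen : ∀ (i : ℤ) (d : ℕ), gauge (polarBody K) (p i - p (i + d)) ≤ σ (i + d) - σ i := by
    intro i d
    induction d with
    | zero => simp
    | succ d ih =>
      push_cast
      have h1 := h.reflect (i + d)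
      have hlt := h.lt_succ (i + d)
      rw [← add_assoc]
      have h2 : p i - p (i + d + 1) = (p i - p (i + d)) +
          (σ (i + d + 1) - σ (i + d)) • outerNormal K (q (i + d)) := by rw [h1]; abel
      have h3 : gauge (polarBody K) (outerNormal K (q (i + d))) ≤ 1 := gauge_le_one_of_mem
        ((hasNormal_outerNormal (h.diff_q _)).mem_polarBody hK.isNormBody)
      rw [h2]
      refine (hT.gauge_add_le _ _).trans ?_
      rw [gauge_smul_nonneg _ (by linarith)]
      have : (σ (i + d + 1) - σ (i + d)) * gauge (polarBody K) (outerNormal K (q (i + d))) ≤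
          (σ (i + d + 1) - σ (i + d)) * 1 := mul_le_mul_of_nonneg_left h3 (by linarith)
      linarith
  -- As `c = 2e + 1`, removing `e` full periods from `M` leaves exactly half a period, still
  -- antipodal. Each half takes time at least two, so `S ≥ 4`, and `c S = 4` forces `c = 1`.
  have hM' : 2 * (M - e * m) = m := by rw [mul_sub, hc, he]; ring
  obtain ⟨d, hd⟩ : ∃ d : ℕ, M - e * m = d := ⟨(M - e * m).toNat, by omega⟩
  have hpper : ∀ c i : ℤ, p (i + c * m) = p i := by
    intro c
    induction c using Int.induction_on with
    | zero => simp
    | succ c ih =>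
      intro i
      rw [show i + ((c : ℤ) + 1) * m = i + c * m + m by ring, h.periodic_p, ih]
    | pred c ih =>
      intro i
      rw [← h.periodic_p, show i + (-(c : ℤ) - 1) * m + m = i + -(c : ℤ) * m by ring, ih]
  have hanti : ∀ i, p (i + d) = -p i := by
    intro i
    rw [← hd, ← (hA i).2.1, ← hpper (-e) (i + M)]
    congr 1; ring
  have htwo : ∀ i, 2 ≤ σ (i + d) - σ i := by
    intro i
    have h1 := hlen i d
    rw [hanti, sub_neg_eq_add, ← two_smul ℝ, gauge_smul_nonneg _ zero_le_two, h.gauge_p] at h1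
    linarith
  have hS4 : 4 ≤ S := by
    have h1 := htwo 0
    have h2 := htwo (0 + d)
    have h3 := hS 0
    rw [show (0 : ℤ) + m = 0 + d + d by omega] at h3
    linarith
  have hc1 : c = 1 := by
    have h1 : 0 < c := by
      by_contra! hle
      have : (c : ℝ) ≤ 0 := by exact_mod_cast hle
      nlinarith
    by_contra hne
    have h2 : (2 : ℝ) ≤ c := by exact_mod_cast (show (2 : ℤ) ≤ c by omega)
    nlinarith
  rw [hc1] at hcS
  rw [hS]
  push_cast at hcS
  linarith

/-! ### Merging two periodic sequences of times -/

/-- The increasing sequence `t` enumerates the disjoint sequences `σ₁` and `σ₂` of times, and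
`u i`, `v i` are the indices of their last members up to the time `t i`. -/
structure IsMerge (σ₁ σ₂ : ℤ → ℝ) (m₁ m₂ : ℤ) (t : ℤ → ℝ) (u v : ℤ → ℤ) : Prop where
  strictMono : StrictMono t
  le_u : ∀ i, σ₁ (u i) ≤ t i
  lt_u : ∀ i, t i < σ₁ (u i + 1)
  le_v : ∀ i, σ₂ (v i) ≤ t i
  lt_v : ∀ i, t i < σ₂ (v i + 1)
  step : ∀ i, (u (i + 1) = u i + 1 ∧ v (i + 1) = v i ∧ t (i + 1) = σ₁ (u (i + 1)) ∧
      σ₂ (v (i + 1)) < t (i + 1)) ∨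
    (v (i + 1) = v i + 1 ∧ u (i + 1) = u i ∧ t (i + 1) = σ₂ (v (i + 1)) ∧
      σ₁ (u (i + 1)) < t (i + 1))
  shift_u : ∀ i, u (i + (m₁ + m₂)) = u i + m₁
  shift_v : ∀ i, v (i + (m₁ + m₂)) = v i + m₂
  shift_t : ∀ i, t (i + (m₁ + m₂)) = t i + 4
  mem₁ : ∀ j, ∃ i, t i = σ₁ j
  mem₂ : ∀ j, ∃ i, t i = σ₂ j

/-- No member of either sequence lies strictly between consecutive merged times, and by disjointness
only one sequence has a member at `t (i + 1)`. The lemma is used twice, with the roles of the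
sequences exchanged. -/
theorem StrictMono.merge_step {σ₁ σ₂ t : ℤ → ℝ} {u v : ℤ → ℤ} (ht : StrictMono t)
    (h₁ : StrictMono σ₁) (h₂ : StrictMono σ₂) (hdis : ∀ i j, σ₁ i ≠ σ₂ j)
    (mem₁ : ∀ j, ∃ i, t i = σ₁ j) (mem₂ : ∀ j, ∃ i, t i = σ₂ j)
    (hu : ∀ i, σ₁ (u i) ≤ t i ∧ t i < σ₁ (u i + 1))
    (hv : ∀ i, σ₂ (v i) ≤ t i ∧ t i < σ₂ (v i + 1)) {i j : ℤ} (hj : t (i + 1) = σ₁ j) :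
    u (i + 1) = u i + 1 ∧ v (i + 1) = v i ∧ t (i + 1) = σ₁ (u (i + 1)) ∧
      σ₂ (v (i + 1)) < t (i + 1) := by
  have hti : t i < t (i + 1) := ht (by omega)
  have e1 : u (i + 1) = j :=
    h₁.floor_unique (hu _).1 (hu _).2 hj.ge (by rw [hj]; exact h₁ (by omega))
  have e2 : u i = j - 1 := by
    refine h₁.floor_unique (hu _).1 (hu _).2 ?_ (by rw [sub_add_cancel, ← hj]; exact hti)
    by_contra! hlt
    obtain ⟨k, hk⟩ := mem₁ (j - 1)
    rw [← hk] at hlt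
    have h3 := ht.lt_iff_lt.1 hlt
    have h4 : t k < t (i + 1) := by rw [hk, hj]; exact h₁ (by omega)
    have h5 := ht.lt_iff_lt.1 h4
    omega
  have hlt : t (i + 1) < σ₂ (v i + 1) := by
    obtain ⟨k, hk⟩ := mem₂ (v i + 1)
    have h3 := (hv i).2
    rw [← hk] at h3
    have h4 := ht.lt_iff_lt.1 h3
    refine lt_of_le_of_ne ?_ ?_
    · rw [← hk]; exact ht.monotone (by omega)
    · rw [hj]; exact hdis _ _
  have e3 : v (i + 1) = v i :=
    h₂.floor_unique (hv _).1 (hv _).2 ((hv i).1.trans hti.le) hlt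
  refine ⟨by omega, e3, by rw [e1, hj], lt_of_le_of_ne (hv _).1 ?_⟩
  rw [hj]
  exact (hdis _ _).symm

theorem exists_isMerge {σ₁ σ₂ : ℤ → ℝ} {m₁ m₂ : ℤ} (h₁ : StrictMono σ₁) (h₂ : StrictMono σ₂)
    (s₁ : ∀ i, σ₁ (i + m₁) = σ₁ i + 4) (s₂ : ∀ i, σ₂ (i + m₂) = σ₂ i + 4)
    (hdis : ∀ i j, σ₁ i ≠ σ₂ j) :
    ∃ t u v, IsMerge σ₁ σ₂ m₁ m₂ t u v ∧ t 1 = σ₂ 1 := by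
  set S := Set.range σ₁ ∪ Set.range σ₂ with hS
  have four : (0 : ℝ) < 4 := by norm_num
  obtain ⟨e, he, hr⟩ := exists_strictMono_range_eq S ⟨σ₁ 0, .inl ⟨0, rfl⟩⟩ (by
    intro a b
    refine (((h₁.finite_preimage_Icc four s₁ a b).image σ₁).union
      ((h₂.finite_preimage_Icc four s₂ a b).image σ₂)).subset ?_
    rintro _ ⟨⟨j, rfl⟩ | ⟨j, rfl⟩, hx⟩
    · exact .inl ⟨j, hx, rfl⟩
    · exact .inr ⟨j, hx, rfl⟩) (by
    rintro _ (⟨j, rfl⟩ | ⟨j, rfl⟩)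
    · exact ⟨_, .inl ⟨j + 1, rfl⟩, h₁ (by omega)⟩
    · exact ⟨_, .inr ⟨j + 1, rfl⟩, h₂ (by omega)⟩) (by
    rintro _ (⟨j, rfl⟩ | ⟨j, rfl⟩)
    · exact ⟨_, .inl ⟨j - 1, rfl⟩, h₁ (by omega)⟩
    · exact ⟨_, .inr ⟨j - 1, rfl⟩, h₂ (by omega)⟩)
  obtain ⟨i₀, hi₀⟩ : σ₂ 1 ∈ Set.range e := by rw [hr]; exact .inr ⟨1, rfl⟩
  -- Renumbered so that index one is the first reflection of the second trajectory, where the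
  -- initial data are prescribed.
  set t : ℤ → ℝ := fun i => e (i + (i₀ - 1)) with htdef
  have ht : StrictMono t := fun i j hij => he (by omega)
  have memS : ∀ x ∈ S, ∃ i, t i = x := by
    intro x hx
    rw [← hr] at hx
    obtain ⟨i, rfl⟩ := hx
    exact ⟨i - (i₀ - 1), by simp [htdef]⟩
  have inS : ∀ i, t i ∈ S := fun i => by rw [← hr]; exact ⟨_, rfl⟩
  have mem₁ : ∀ j, ∃ i, t i = σ₁ j := fun j => memS _ (.inl ⟨j, rfl⟩)
  have mem₂ : ∀ j, ∃ i, t i = σ₂ j := fun j => memS _ (.inr ⟨j, rfl⟩)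
  choose u hu using fun i => h₁.exists_floor four s₁ (t i)
  choose v hv using fun i => h₂.exists_floor four s₂ (t i)
  have step : ∀ i, (u (i + 1) = u i + 1 ∧ v (i + 1) = v i ∧ t (i + 1) = σ₁ (u (i + 1)) ∧
      σ₂ (v (i + 1)) < t (i + 1)) ∨
    (v (i + 1) = v i + 1 ∧ u (i + 1) = u i ∧ t (i + 1) = σ₂ (v (i + 1)) ∧
      σ₁ (u (i + 1)) < t (i + 1)) := by
    intro i
    rcases inS (i + 1) with ⟨j, hj⟩ | ⟨j, hj⟩
    · exact .inl (ht.merge_step h₁ h₂ hdis mem₁ mem₂ hu hv hj.symm)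
    · exact .inr (ht.merge_step h₂ h₁ (fun i j => (hdis j i).symm) mem₂ mem₁ hv hu hj.symm)
  have hshift : ∀ {σ : ℤ → ℝ} {m : ℤ}, (∀ i, σ (i + m) = σ i + 4) →
      ∀ x, x ∈ Set.range σ ↔ x + 4 ∈ Set.range σ := by
    intro σ m hσ x
    constructor
    · rintro ⟨j, rfl⟩; exact ⟨j + m, hσ j⟩
    · rintro ⟨j, hj⟩
      refine ⟨j - m, ?_⟩
      have := hσ (j - m)
      rw [sub_add_cancel] at this
      linarith
  obtain ⟨N, hN⟩ := ht.exists_shift (c := (4 : ℝ)) (by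
    have hrt : Set.range t = S := by
      ext x
      constructor
      · rintro ⟨i, rfl⟩; exact inS i
      · exact memS x
    intro x
    rw [hrt, hS, Set.mem_union, Set.mem_union, hshift s₁ x, hshift s₂ x])
  have hNu : ∀ i, u (i + N) = u i + m₁ := fun i =>
    h₁.floor_unique (hu _).1 (hu _).2 (by rw [hN, s₁]; linarith [(hu i).1])
      (by rw [hN, add_right_comm, s₁]; linarith [(hu i).2])
  have hNv : ∀ i, v (i + N) = v i + m₂ := fun i =>
    h₂.floor_unique (hv _).1 (hv _).2 (by rw [hN, s₂]; linarith [(hv i).1])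
      (by rw [hN, add_right_comm, s₂]; linarith [(hv i).2])
  -- Every step advances exactly one of `u` and `v`, so `u i + v i - i` is constant.
  have hNm : N = m₁ + m₂ := by
    have := int_eq_of_succ_eq (f := fun i => u i + v i - i) (fun i => by
      rcases step i with h | h <;> rw [h.1, h.2.1] <;> ring) (0 + N) 0
    rw [hNu, hNv] at this
    omega
  subst hNm
  exact ⟨t, u, v, ⟨ht, fun i => (hu i).1, fun i => (hu i).2, fun i => (hv i).1, fun i => (hv i).2,
    step, hNu, hNv, hN, mem₁, mem₂⟩, by simp [htdef, hi₀]⟩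

namespace IsMerge

variable {σ₁ σ₂ : ℤ → ℝ} {m₁ m₂ : ℤ} {t : ℤ → ℝ} {u v : ℤ → ℤ}

theorem monotone_u (h : IsMerge σ₁ σ₂ m₁ m₂ t u v) : Monotone u :=
  monotone_int_of_le_succ fun i => by rcases h.step i with h | h <;> omega

theorem monotone_v (h : IsMerge σ₁ σ₂ m₁ m₂ t u v) : Monotone v :=
  monotone_int_of_le_succ fun i => by rcases h.step i with h | h <;> omega

theorem exists_u (h : IsMerge σ₁ σ₂ m₁ m₂ t u v) (h₁ : StrictMono σ₁) (j : ℤ) :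
    ∃ i, u i = j ∧ t i = σ₁ j := by
  obtain ⟨i, hi⟩ := h.mem₁ j
  exact ⟨i, h₁.floor_unique (h.le_u i) (h.lt_u i) hi.ge (by rw [hi]; exact h₁ (by omega)), hi⟩

theorem exists_v (h : IsMerge σ₁ σ₂ m₁ m₂ t u v) (h₂ : StrictMono σ₂) (j : ℤ) :
    ∃ i, v i = j ∧ t i = σ₂ j := by
  obtain ⟨i, hi⟩ := h.mem₂ j
  exact ⟨i, h₂.floor_unique (h.le_v i) (h.lt_v i) hi.ge (by rw [hi]; exact h₂ (by omega)), hi⟩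

end IsMerge

/-! ### Closed polygonal lines -/

theorem polygonPoint_add {n : ℕ} (R : ℤ → Fin n → ℝ) (j : ℤ) {s : ℝ} (h0 : 0 ≤ s) (h1 : s < 1) :
    polygonPoint R (j + s) = R j + s • (R (j + 1) - R j) := by
  have e1 : ⌊(j : ℝ) + s⌋ = j := by
    rw [Int.floor_eq_iff]; constructor <;> linarith
  rw [polygonPoint, Int.fract, e1, add_sub_cancel_left, AffineMap.lineMap_apply_module']
  abel

theorem sameClosedPolygon_comp {n : ℕ} {R : ℤ → Fin n → ℝ} {N m : ℕ} {u : ℤ → ℤ}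
    (hu : Monotone u) (hN : ∀ i, u (i + N) = u i + m) (hs : ∀ j, ∃ i, u i = j) :
    SameClosedPolygon N (fun i => R (u i)) m R := by
  refine ⟨fun i => u i, fun i j hij => Int.cast_le.2 (hu hij), fun i => ?_, fun i => ?_,
    fun j => ?_⟩
  · dsimp only
    exact_mod_cast hN i
  · have := polygonPoint_add R (u i) le_rfl one_pos
    simpa using this.symm
  · obtain ⟨i, hi⟩ := hs j
    exact ⟨i, congrArg _ hi⟩

theorem sameClosedPolygon_of_times {n : ℕ} {P R : ℤ → Fin n → ℝ} {N m : ℕ} {u : ℤ → ℤ}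
    {t σ : ℤ → ℝ} (ht : StrictMono t) (hσ : StrictMono σ) (hle : ∀ i, σ (u i) ≤ t i)
    (hlt : ∀ i, t i < σ (u i + 1)) (hu : Monotone u) (hN : ∀ i, u (i + N) = u i + m)
    (htN : ∀ i, t (i + N) = t i + 4) (hσm : ∀ i, σ (i + m) = σ i + 4)
    (hs : ∀ j, ∃ i, u i = j ∧ t i = σ j)
    (hP : ∀ i, P i = R (u i) +
      ((t i - σ (u i)) / (σ (u i + 1) - σ (u i))) • (R (u i + 1) - R (u i))) :
    SameClosedPolygon N P m R := by
  have hd : ∀ j, 0 < σ (j + 1) - σ j := fun j => sub_pos.2 (hσ (by omega))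
  have f0 : ∀ i, 0 ≤ (t i - σ (u i)) / (σ (u i + 1) - σ (u i)) := fun i =>
    div_nonneg (sub_nonneg.2 (hle i)) (hd _).le
  have f1 : ∀ i, (t i - σ (u i)) / (σ (u i + 1) - σ (u i)) < 1 := fun i => by
    rw [div_lt_one (hd _)]; linarith [hlt i]
  -- The polygon parameter: the number of the current edge plus the fraction of that edge's time
  -- already elapsed.
  refine ⟨fun i => u i + (t i - σ (u i)) / (σ (u i + 1) - σ (u i)), ?_, ?_, ?_, ?_⟩
  · intro i j hij
    dsimp only
    rcases (hu hij).eq_or_lt with h | h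
    · rw [h]
      have := ht.monotone hij
      have := (hd (u j)).le
      gcongr
    · have h2 : (u i : ℝ) + 1 ≤ u j := by exact_mod_cast h
      linarith [f0 j, f1 i]
  · intro i
    dsimp only
    rw [hN, htN, hσm, add_right_comm, hσm]
    push_cast
    rw [add_sub_add_right_eq_sub, add_sub_add_right_eq_sub]
    ring
  · intro i
    rw [polygonPoint_add R _ (f0 i) (f1 i), hP]
  · intro j
    obtain ⟨i, h1, h2⟩ := hs j
    refine ⟨i, ?_⟩
    dsimp only
    rw [h1, h2, sub_self, zero_div, add_zero]

/-! ### Composing trajectories -/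

namespace IsTimedTrajectory

variable {n : ℕ} {K T : Set (Fin n → ℝ)} {m : ℤ} {q p : ℤ → Fin n → ℝ} {σ : ℤ → ℝ}

theorem add_const (h : IsTimedTrajectory K T m q p σ) (c : ℝ) :
    IsTimedTrajectory K T m q p (fun i => σ i + c) where
  pos := h.pos
  periodic_q := h.periodic_q
  periodic_p := h.periodic_p
  gauge_q := h.gauge_q
  gauge_p := h.gauge_p
  diff_q := h.diff_q
  diff_p := h.diff_p
  lt_succ i := add_lt_add_left (h.lt_succ i) c
  reflect i := by rw [add_sub_add_right_eq_sub]; exact h.reflect i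
  move := h.move

theorem succ_ne (h : IsTimedTrajectory K T m q p σ) (i : ℤ) : q (i + 1) ≠ q i := by
  obtain ⟨b, hb, e⟩ := h.move i
  rw [e, Ne, add_eq_left, smul_eq_zero, not_or]
  exact ⟨hb.ne', (hasNormal_outerNormal (h.diff_p _)).ne_zero' (by rw [h.gauge_p]; exact one_pos)⟩

/-- The momentum at time `s`, between the reflections number `j` and `j + 1`. -/
theorem path_eq (h : IsTimedTrajectory K T m q p σ) (j : ℤ) (s : ℝ) :
    p j - (s - σ j) • outerNormal K (q j) =
      p j + ((s - σ j) / (σ (j + 1) - σ j)) • (p (j + 1) - p j) := by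
  have := (sub_pos.2 (h.lt_succ j)).ne'
  rw [h.reflect j, sub_sub_cancel_left, smul_neg, smul_smul, div_mul_cancel₀ _ this,
    sub_eq_add_neg]

theorem gauge_path_lt {K : Set (Fin n → ℝ)} (hK : IsHanner n K)
    (h : IsTimedTrajectory K (polarBody K) m q p σ) {j : ℤ} {s : ℝ} (h1 : σ j < s)
    (h2 : s < σ (j + 1)) :
    gauge (polarBody K) (p j - (s - σ j) • outerNormal K (q j)) < 1 := by
  have np := hasNormal_outerNormal (h.diff_p j)
  have nq := hasNormal_outerNormal (h.diff_q j)
  rw [sub_eq_add_neg, ← smul_neg]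
  refine np.gauge_chord_lt hK.polarBody.isNormBody (h.gauge_p j) ?_ (a := σ (j + 1) - σ j) ?_
    (by linarith) (by linarith)
  · rw [dotProduct_neg, neg_ne_zero, dotProduct_comm]
    exact ne_zero_of_eq_one_or_neg_one (hK.dotProduct_normals nq np)
  · rw [smul_neg, ← sub_eq_add_neg, ← h.reflect, h.gauge_p]

end IsTimedTrajectory

theorem IsSimpleClassicalTrajectory.exists_timed {n : ℕ} {K : Set (Fin n → ℝ)}
    (hK : IsHanner n K) {m : ℕ} {q p : ℤ → Fin n → ℝ}
    (h : IsSimpleClassicalTrajectory K (polarBody K) m q p) :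
    ∃ σ : ℤ → ℝ, σ 1 = 0 ∧ IsTimedTrajectory K (polarBody K) m q p σ ∧
      ∀ i, σ (i + m) = σ i + 4 := by
  have hB := hK.isNormBody
  have hT := hK.polarBody.isNormBody
  choose a ha e using fun i => (h.step i).reflect
  obtain ⟨σ, hσ⟩ := exists_int_antidifference a
  have ht : IsTimedTrajectory K (polarBody K) m q p σ :=
    { pos := by have := h.two_le; omega
      periodic_q := h.periodic_q
      periodic_p := h.periodic_p
      gauge_q := fun i => hB.mem_frontier_iff.1 (h.step i).smooth_q.1
      gauge_p := fun i => hT.mem_frontier_iff.1 (h.step i).smooth_p.1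
      diff_q := fun i => (h.step i).smooth_q.2
      diff_p := fun i => (h.step i).smooth_p.2
      lt_succ := fun i => by rw [hσ]; linarith [ha i]
      reflect := fun i => by
        rw [hσ, add_sub_cancel_left, sub_eq_add_neg, ← e i]; abel
      move := fun i => by
        obtain ⟨b, hb, e⟩ := (h.step i).move
        exact ⟨b, hb, by rw [← e]; abel⟩ }
  have ht' := ht.add_const (-σ 1)
  exact ⟨_, by simp, ht', ht'.action_eq_four hK h.simple⟩

section Compose

variable {k l : ℕ} {K : Set (Fin k → ℝ)} {L : Set (Fin l → ℝ)} {m₁ m₂ : ℕ}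
  {q₁ p₁ : ℤ → Fin k → ℝ} {q₂ p₂ : ℤ → Fin l → ℝ} {σ₁ σ₂ t : ℤ → ℝ} {u v : ℤ → ℤ} {α : ℝ}

/-- At each merged time one momentum is on its boundary and the other, by `gauge_path_lt`, is
strictly inside. This gives smoothness of the pair in `H°`, and its normal lies in a single block.
-/
theorem IsMerge.billiardStep (hK : IsHanner k K) (hL : IsHanner l L)
    (h₁ : IsTimedTrajectory K (polarBody K) m₁ q₁ p₁ σ₁)
    (h₂ : IsTimedTrajectory L (polarBody L) m₂ q₂ p₂ σ₂)
    (h : IsMerge σ₁ σ₂ m₁ m₂ t u v) (hα : α ∈ Set.Ioo (0 : ℝ) 1) {q p : ℤ → Fin (k + l) → ℝ}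
    (hq : ∀ i, q i = Fin.append (α • q₁ (u i)) ((1 - α) • q₂ (v i)))
    (hp : ∀ i, p i = Fin.append (p₁ (u i) - (t i - σ₁ (u i)) • outerNormal K (q₁ (u i)))
      (p₂ (v i) - (t i - σ₂ (v i)) • outerNormal L (q₂ (v i)))) (i : ℤ) :
    BilliardStep (oplusOne K L) (polarBody (oplusOne K L)) (q i) (p i) (q (i + 1))
      (p (i + 1)) := by
  have bK := hK.isNormBody
  have bL := hL.isNormBody
  have bK' := hK.polarBody.isNormBody
  have bL' := hL.polarBody.isNormBody
  have hα' : 0 < 1 - α := by linarith [hα.2]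
  have nq : ∀ i, HasNormal (oplusOne K L) (q i)
      (Fin.append (outerNormal K (q₁ (u i))) (outerNormal L (q₂ (v i)))) := by
    intro i
    rw [hasNormal_oplusOne bK bL, hq]
    simp only [firstPart_append, lastPart_append]
    exact ⟨(hasNormal_outerNormal (h₁.diff_q _)).smul hα.1,
      (hasNormal_outerNormal (h₂.diff_q _)).smul hα'⟩
  have gq : ∀ i, gauge (oplusOne K L) (q i) = 1 := by
    intro i
    rw [gauge_oplusOne bK bL, hq]
    simp only [firstPart_append, lastPart_append]
    rw [gauge_smul_nonneg _ hα.1.le, gauge_smul_nonneg _ hα'.le, h₁.gauge_q, h₂.gauge_q]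
    ring
  have sq : ∀ i, IsSmoothBoundaryPoint (oplusOne K L) (q i) := fun i =>
    ⟨(bK.oplusOne bL).mem_frontier_iff.2 (gq i), (nq i).differentiableAt⟩
  have sp : ∀ i, IsSmoothBoundaryPoint (polarBody (oplusOne K L)) (p (i + 1)) ∧
      ∃ b : ℝ, 0 < b ∧ q (i + 1) - q i =
        b • outerNormal (polarBody (oplusOne K L)) (p (i + 1)) := by
    intro i
    rw [hK.polarBody_oplusOne hL]
    rcases h.step i with ⟨eu, ev, et, hlt⟩ | ⟨ev, eu, et, hlt⟩
    · have g2 := h₂.gauge_path_lt hL hlt (h.lt_v _)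
      have e1 : firstPart (p (i + 1)) = p₁ (u (i + 1)) := by
        rw [hp, firstPart_append, et, sub_self, zero_smul, sub_zero]
      have e2 : gauge (polarBody L) (lastPart (p (i + 1))) < 1 := by
        rw [hp, lastPart_append]; exact g2
      have g1 : gauge (polarBody K) (firstPart (p (i + 1))) = 1 := by rw [e1, h₁.gauge_p]
      have hn : HasNormal (oplusInf (polarBody K) (polarBody L)) (p (i + 1))
          (Fin.append (outerNormal (polarBody K) (p₁ (u (i + 1)))) 0) := by
        rw [hasNormal_oplusInf_left bK' bL' (by rw [g1]; exact e2), e1, firstPart_append,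
          lastPart_append]
        exact ⟨hasNormal_outerNormal (h₁.diff_p _), rfl⟩
      refine ⟨⟨(bK'.oplusInf bL').mem_frontier_iff.2 ?_, hn.differentiableAt⟩, ?_⟩
      · rw [gauge_oplusInf bK' bL', g1, max_eq_left e2.le]
      · obtain ⟨b, hb, e⟩ := h₁.move (u i)
        refine ⟨α * b, mul_pos hα.1 hb, ?_⟩
        rw [hn.outerNormal_eq, hq, hq, ev, eu, e]
        apply parts_ext <;> simp [mul_smul]
    · have g1 := h₁.gauge_path_lt hK hlt (h.lt_u _)
      have e2 : lastPart (p (i + 1)) = p₂ (v (i + 1)) := by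
        rw [hp, lastPart_append, et, sub_self, zero_smul, sub_zero]
      have e1 : gauge (polarBody K) (firstPart (p (i + 1))) < 1 := by
        rw [hp, firstPart_append]; exact g1
      have g2 : gauge (polarBody L) (lastPart (p (i + 1))) = 1 := by rw [e2, h₂.gauge_p]
      have hn : HasNormal (oplusInf (polarBody K) (polarBody L)) (p (i + 1))
          (Fin.append 0 (outerNormal (polarBody L) (p₂ (v (i + 1))))) := by
        rw [hasNormal_oplusInf_right bK' bL' (by rw [g2]; exact e1), e2, firstPart_append,
          lastPart_append]
        exact ⟨hasNormal_outerNormal (h₂.diff_p _), rfl⟩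
      refine ⟨⟨(bK'.oplusInf bL').mem_frontier_iff.2 ?_, hn.differentiableAt⟩, ?_⟩
      · rw [gauge_oplusInf bK' bL', g2, max_eq_right e1.le]
      · obtain ⟨b, hb, e⟩ := h₂.move (v i)
        refine ⟨(1 - α) * b, mul_pos hα' hb, ?_⟩
        rw [hn.outerNormal_eq, hq, hq, ev, eu, e]
        apply parts_ext <;> simp [mul_smul]
  refine ⟨sq _, ?_, sq _, (sp i).1, ?_, (sp i).2⟩
  · have := (sp (i - 1)).1
    rwa [sub_add_cancel] at this
  · refine ⟨t (i + 1) - t i, sub_pos.2 (h.strictMono (by omega)), ?_⟩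
    rw [(nq i).outerNormal_eq, hp, hp]
    rcases h.step i with ⟨eu, ev, et, -⟩ | ⟨ev, eu, et, -⟩
    · have r := h₁.reflect (u i)
      rw [← eu] at r
      apply parts_ext
      · simp only [firstPart_sub, firstPart_neg, firstPart_smul, firstPart_append]
        rw [r, et]
        module
      · simp only [lastPart_sub, lastPart_neg, lastPart_smul, lastPart_append]
        rw [ev]
        module
    · have r := h₂.reflect (v i)
      rw [← ev] at r
      apply parts_ext
      · simp only [firstPart_sub, firstPart_neg, firstPart_smul, firstPart_append]
        rw [eu]
        module
      · simp only [lastPart_sub, lastPart_neg, lastPart_smul, lastPart_append]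
        rw [r, et]
        module

theorem IsMerge.isSimple (h₁ : IsTimedTrajectory K (polarBody K) m₁ q₁ p₁ σ₁)
    (s₁ : ∀ d : ℕ, 0 < d → d < m₁ → ¬ ∀ i, q₁ (i + d) = q₁ i)
    (h : IsMerge σ₁ σ₂ m₁ m₂ t u v) (hα : α ∈ Set.Ioo (0 : ℝ) 1) {q : ℤ → Fin (k + l) → ℝ}
    (hq : ∀ i, q i = Fin.append (α • q₁ (u i)) ((1 - α) • q₂ (v i))) (d : ℕ) (hd : 0 < d)
    (hdN : d < m₁ + m₂) : ¬ ∀ i, q (i + d) = q i := by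
  intro hper
  have h1 : ∀ i, q₁ (u (i + d)) = q₁ (u i) := by
    intro i
    have := congrArg firstPart (hper i)
    rw [hq, hq, firstPart_append, firstPart_append] at this
    exact smul_right_injective _ hα.1.ne' this
  -- Consecutive points of `q₁` differ, so a step advances `u` exactly when the first block of `q`
  -- changes; the `d`-periodicity of `q` makes the advances of `u` `d`-periodic.
  have hu : ∀ i, u (i + d) = u i + (u (0 + d) - u 0) := by
    intro i
    have := int_eq_of_succ_eq (f := fun i => u (i + d) - u i) (fun i => by
      have e := h1 (i + 1)
      rw [add_right_comm] at e ⊢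
      rcases h.step i with ⟨ei, -⟩ | ⟨-, ei, -⟩ <;>
        rcases h.step (i + d) with ⟨ed, -⟩ | ⟨-, ed, -⟩
      · omega
      · rw [ed, ei, h1] at e
        exact absurd e.symm (h₁.succ_ne _)
      · rw [ed, ei, ← h1 i] at e
        exact absurd e (h₁.succ_ne _)
      · omega) i 0
    omega
  set d₁ := u (0 + d) - u 0 with hd₁
  have hq₁ : ∀ j, q₁ (j + d₁) = q₁ j := by
    intro j
    obtain ⟨i, rfl, -⟩ := h.exists_u h₁.strictMono j
    rw [← hu, h1]
  -- The advance of `u` over `d (m₁ + m₂)` steps, counted in two ways. It gives `0 < d₁ < m₁`, and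
  -- `d₁` is a period of `q₁`, which contradicts simplicity.
  have hmul : (d : ℤ) * m₁ = (m₁ + m₂ : ℤ) * d₁ := by
    have a1 := add_mul_of_add_eq (σ := fun i => (u i : ℝ)) (m := (m₁ + m₂ : ℤ)) (T := m₁)
      (fun i => by rw [h.shift_u]; push_cast; ring) d 0
    have a2 := add_mul_of_add_eq (σ := fun i => (u i : ℝ)) (m := d) (T := d₁)
      (fun i => by rw [hu]; push_cast; ring) (m₁ + m₂) 0
    rw [mul_comm ((m₁ : ℤ) + m₂) (d : ℤ)] at a2
    have a3 := a1.symm.trans a2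
    rw [add_right_inj] at a3
    exact_mod_cast a3
  have hm := h₁.pos
  have hpos : 0 < d₁ := by
    by_contra! hle
    have : (0 : ℤ) < d * m₁ := by positivity
    nlinarith
  have hlt : d₁ < m₁ := by
    by_contra! hle
    have : (d : ℤ) * m₁ < (m₁ + m₂ : ℤ) * m₁ := by
      apply mul_lt_mul_of_pos_right _ hm
      exact_mod_cast hdN
    nlinarith
  refine s₁ d₁.toNat (by omega) (by omega) fun i => ?_
  rw [Int.toNat_of_nonneg hpos.le, hq₁]

end Compose

theorem finite_coincidences {σ₁ σ₂ : ℤ → ℝ} {m₁ m₂ : ℤ} (h₁ : StrictMono σ₁) (hm₂ : 0 < m₂)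
    (s₁ : ∀ i, σ₁ (i + m₁) = σ₁ i + 4) (s₂ : ∀ i, σ₂ (i + m₂) = σ₂ i + 4) (a b : ℝ) :
    {c : ℝ | c ∈ Set.Icc a b ∧ ∃ i j, σ₁ i + c = σ₂ j}.Finite := by
  have four : (0 : ℝ) < 4 := by norm_num
  refine Set.Finite.subset (Set.Finite.biUnion (Set.finite_Ico (0 : ℤ) m₂) fun j _ =>
    ((h₁.finite_preimage_Icc four s₁ (σ₂ j - b) (σ₂ j - a)).image fun i => σ₂ j - σ₁ i)) ?_
  rintro c ⟨hc, i, j, hij⟩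
  simp only [Set.mem_iUnion]
  -- Moving both indices by the same number of periods keeps a coincidence, because both periods
  -- last four. So `j` may be taken modulo `m₂`, and the bounds on `c` leave finitely many `i`.
  refine ⟨j % m₂, ⟨Int.emod_nonneg _ hm₂.ne', Int.emod_lt_of_pos _ hm₂⟩,
    i + (-(j / m₂)) * m₁, ?_⟩
  have e1 := add_mul_of_add_eq s₁ (-(j / m₂)) i
  have e2 := add_mul_of_add_eq s₂ (j / m₂) (j % m₂)
  rw [mul_comm (j / m₂) m₂, Int.emod_add_mul_ediv] at e2
  push_cast at e1
  simp only [Set.mem_preimage, Set.mem_Icc, e1]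
  have := hc.1
  have := hc.2
  refine ⟨⟨?_, ?_⟩, ?_⟩ <;> linarith

/-! ### The composed trajectory and its exceptional parameters. -/

theorem mainTheorem4 {k l : ℕ} (K : Set (Fin k → ℝ)) (L : Set (Fin l → ℝ))
    (hK : IsHanner k K) (hL : IsHanner l L)
    (m₁ m₂ : ℕ) (q₁ p₁ : ℤ → Fin k → ℝ) (q₂ p₂ : ℤ → Fin l → ℝ)
    (h₁ : IsSimpleClassicalTrajectory K (polarBody K) m₁ q₁ p₁)
    (h₂ : IsSimpleClassicalTrajectory L (polarBody L) m₂ q₂ p₂)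
    (α : ℝ) (hα : α ∈ Set.Ioo (0 : ℝ) 1) :
    {β : ℝ | β ∈ Set.Ioo (0 : ℝ) 1 ∧
      ¬ ∃ (N : ℕ) (q p : ℤ → Fin (k + l) → ℝ),
        -- a simple classical trajectory with the prescribed initial data
        IsSimpleClassicalTrajectory (oplusOne K L) (polarBody (oplusOne K L)) N q p ∧
        q 1 = Fin.append (α • q₁ 1) ((1 - α) • q₂ 1) ∧
        p 1 = Fin.append (β • p₁ 1 + (1 - β) • p₁ 2) (p₂ 1) ∧
        -- it is the only extension of the initial data by the billiard rules
        (∀ q' p' : ℕ → Fin (k + l) → ℝ, q' 0 = q 1 → p' 0 = p 1 →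
          (∀ i, BilliardStep (oplusOne K L) (polarBody (oplusOne K L))
            (q' i) (p' i) (q' (i + 1)) (p' (i + 1))) →
          ∀ i : ℕ, q' i = q (i + 1) ∧ p' i = p (i + 1)) ∧
        -- projections of the coordinate line
        SameClosedPolygon N (fun i => firstPart (q i)) m₁ (fun i => α • q₁ i) ∧
        SameClosedPolygon N (fun i => lastPart (q i)) m₂ (fun i => (1 - α) • q₂ i) ∧
        -- projections of the momentum line
        SameClosedPolygon N (fun i => firstPart (p i)) m₁ p₁ ∧
        SameClosedPolygon N (fun i => lastPart (p i)) m₂ p₂}.Finite := by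
  obtain ⟨τ, τ1, hτ, τs⟩ := h₁.exists_timed hK
  obtain ⟨σ₂, σ1, ht₂, hs₂⟩ := h₂.exists_timed hL
  have ha : 0 < τ 2 := by rw [← τ1]; exact hτ.lt_succ 1
  have hfin := (finite_coincidences hτ.strictMono ht₂.pos τs hs₂ (-τ 2) 0).image
    fun c => 1 + c / τ 2
  refine hfin.subset ?_
  rintro β ⟨hβ, hbad⟩
  -- As `τ 1 = 0`, the first momentum edge lasts `τ 2`. At time zero the fraction `1 - β` of it must
  -- be behind, so the first clock is set back by that share of `τ 2`. Conversely `β = 1 + c / τ 2`.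
  set c := -((1 - β) * τ 2) with hc
  by_contra hβ'
  have hdis : ∀ i j, τ i + c ≠ σ₂ j := by
    intro i j hij
    refine hβ' ⟨c, ⟨⟨?_, ?_⟩, i, j, hij⟩, ?_⟩
    · rw [hc]; nlinarith [hβ.1]
    · rw [hc]; nlinarith [hβ.2]
    · dsimp only
      rw [hc]; field_simp; ring
  apply hbad
  have ht₁ := hτ.add_const c
  have hs₁ : ∀ i, τ (i + m₁) + c = τ i + c + 4 := fun i => by rw [τs]; ring
  obtain ⟨t, u, v, hM, t1⟩ := exists_isMerge ht₁.strictMono ht₂.strictMono hs₁ hs₂ hdis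
  set σ₁ : ℤ → ℝ := fun i => τ i + c with hσ₁
  set q : ℤ → Fin (k + l) → ℝ := fun i => Fin.append (α • q₁ (u i)) ((1 - α) • q₂ (v i)) with hq
  set p : ℤ → Fin (k + l) → ℝ := fun i =>
    Fin.append (p₁ (u i) - (t i - σ₁ (u i)) • outerNormal K (q₁ (u i)))
      (p₂ (v i) - (t i - σ₂ (v i)) • outerNormal L (q₂ (v i))) with hp
  have hstep := hM.billiardStep hK hL ht₁ ht₂ hα (q := q) (p := p) (fun _ => rfl) fun _ => rfl
  have hN : ((m₁ + m₂ : ℕ) : ℤ) = m₁ + m₂ := Nat.cast_add _ _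
  -- At time `t 1 = 0` the first momentum is on the edge from `p₁ 1` to `p₁ 2`: its reflections one
  -- and two happen at `c < 0` and `τ 2 + c = β τ 2 > 0`.
  have u1 : u 1 = 1 := by
    refine ht₁.strictMono.floor_unique (hM.le_u 1) (hM.lt_u 1) ?_ ?_
    · rw [t1, σ1]
      change τ 1 + c ≤ 0
      rw [τ1, hc]; nlinarith [hβ.2]
    · rw [t1, σ1]
      change 0 < τ 2 + c
      rw [hc]; nlinarith [hβ.1]
  have v1 : v 1 = 1 := ht₂.strictMono.floor_unique (hM.le_v 1) (hM.lt_v 1) t1.ge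
    (by rw [t1]; exact ht₂.lt_succ 1)
  have per_q : ∀ i, q (i + (m₁ + m₂ : ℕ)) = q i := by
    intro i
    simp only [hq, hN, hM.shift_u, hM.shift_v, h₁.periodic_q, h₂.periodic_q]
  have per_p : ∀ i, p (i + (m₁ + m₂ : ℕ)) = p i := by
    intro i
    simp only [hp, hN, hM.shift_u, hM.shift_v, hM.shift_t, h₁.periodic_q, h₂.periodic_q,
      h₁.periodic_p, h₂.periodic_p]
    have e1 : σ₁ (u i + m₁) = σ₁ (u i) + 4 := hs₁ _
    rw [e1, hs₂, add_sub_add_right_eq_sub, add_sub_add_right_eq_sub]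
  refine ⟨m₁ + m₂, q, p, ⟨⟨?_, per_q, per_p, hstep⟩, ?_⟩, ?_, ?_, ?_, ?_, ?_, ?_, ?_⟩
  · have := h₁.two_le
    omega
  · exact hM.isSimple ht₁ h₁.simple hα fun _ => rfl
  · simp only [hq, u1, v1]
  · simp only [hp, u1, v1, t1]
    rw [sub_self, zero_smul, sub_zero, σ1]
    congr 1
    have r := hτ.reflect 1
    rw [show (1 : ℤ) + 1 = 2 from rfl, τ1, sub_zero] at r
    have e : σ₁ 1 = -((1 - β) * τ 2) := by simp only [hσ₁, τ1, zero_add, hc]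
    rw [r, e]
    module
  · intro q' p' hq' hp' hstep' i
    induction i with
    | zero => exact ⟨by simpa using hq', by simpa using hp'⟩
    | succ i ih =>
      have := hstep' i
      rw [ih.1, ih.2] at this
      have h3 := BilliardStep.unique (hK.sumOne hL) this (hstep (i + 1))
      exact_mod_cast h3
  · simp only [hq, firstPart_append]
    exact sameClosedPolygon_comp (R := fun i => α • q₁ i) hM.monotone_u
      (fun i => by rw [hN, hM.shift_u])
      fun j => (hM.exists_u ht₁.strictMono j).imp fun _ h => h.1
  · simp only [hq, lastPart_append]
    exact sameClosedPolygon_comp (R := fun i => (1 - α) • q₂ i) hM.monotone_v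
      (fun i => by rw [hN, hM.shift_v])
      fun j => (hM.exists_v ht₂.strictMono j).imp fun _ h => h.1
  · simp only [hp, firstPart_append]
    exact sameClosedPolygon_of_times hM.strictMono ht₁.strictMono hM.le_u hM.lt_u hM.monotone_u
      (fun i => by rw [hN, hM.shift_u]) (fun i => by rw [hN, hM.shift_t]) hs₁
      (hM.exists_u ht₁.strictMono) fun i => ht₁.path_eq _ _
  · simp only [hp, lastPart_append]
    exact sameClosedPolygon_of_times hM.strictMono ht₂.strictMono hM.le_v hM.lt_v hM.monotone_v
      (fun i => by rw [hN, hM.shift_v]) (fun i => by rw [hN, hM.shift_t]) hs₂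
      (hM.exists_v ht₂.strictMono) fun i => ht₂.path_eq _ _
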